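/- Let $\mathcal X,\mathcal Y$ be separable real Hilbert spaces with orthonormal (Hilbert) bases $(\xi_j)_{j\in J}$ and $(\psi_k)_{k\in I}$, where $J$ and $I$ are countable index sets (typically $J=\{1,2,\dots\}$ and $I=\{0,1,2,\dots\}$). Let $\rho$ be a Borel probability measure on $\mathcal X$ and let $\rho_j$, $j\in J$, be probability measures on $\mathbb R$ such that (i) $\rho$ is the product of the $\rho_j$ in the coordinates $\hat f_j=\langle \xi_j,f\rangle_{\mathcal X}$; that is, for $f\sim\rho$ the $\hat f_j$ are independent and $\hat f_j$ has law $\rho_j$; (ii) for every $j$: all moments of $\rho_j$ are finite; the distribution function $F_j(x)=\rho_j((-\infty,x])$ has infinitely many points of increase (points $x$ with $F_j(x-\varepsilon)<F_j(x+\varepsilon)$ for all $\varepsilon>0$); and $\rho_j$ is moment determinate, i.e. it is the only Borel probability measure on $\mathbb R$ with its moment sequence. Then for every $j$ there is a unique sequence $(p^j_n)_{n\ge 0}$ of real polynomials with $\deg p^j_n=n$, positive leading coefficients, and $\int_{\mathbb R} p^j_n\,p^j_m\,d\rho_j=\delta_{n,m}$. Let $\mathcal I$ be the set of multi-indices $\alpha=(\alpha_0,(\alpha_j)_{j\in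 J})$ with $\alpha_0\in I$, $\alpha_j\in\{0,1,2,\dots\}$ and $\alpha_j\neq 0$ for only finitely many $j\in J$, and for $\alpha\in\mathcal I$ put $$P_\alpha(f)=\psi_{\alpha_0}\prod_{j\in J}p^j_{\alpha_j}(\hat f_j),\qquad f\in\mathcal X .$$ (Note that $p^j_0\equiv1$, so this is a finite product.) Then every $P_\alpha$ lies in $L^2_\rho(\mathcal X;\mathcal Y)$, and $\{P_\alpha\}_{\alpha\in\mathcal I}$ is a complete orthonormal basis of $L^2_\rho(\mathcal X;\mathcal Y)$. In particular, for every $K\in L^2_\rho(\mathcal X;\mathcal Y)$ and every exhaustion $\Lambda_1\subseteq\Lambda_2\subseteq\cdots$ of $\mathcal I$ by finite sets, $$\lim_{N\to\infty}\int_{\mathcal X}\Big\|K(f)-\sum_{\alpha\in\Lambda_N}c_\alpha P_\alpha(f)\Big\|_{\mathcal Y}^2\,d\rho(f)=0,\qquad c_\alpha=\langle K,P_\alpha\rangle_{L^2_\rho}=\int_{\mathcal X}\langle K(f),P_\alpha(f)\rangle_{\mathcal Y}\,d\rho(f).$$ -/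

import Mathlib

namespace PolyOperator

open MeasureTheory

/-- All (power) moments of `π` are finite. -/
def HasFiniteMoments (π : Measure ℝ) : Prop :=
  ∀ k : ℕ, Integrable (fun x : ℝ => x ^ k) π

/-- Points of increase of a function `F : ℝ → ℝ`: the points `x` such that `F` is not constant on
any neighbourhood of `x` (for a nondecreasing `F`). -/
def pointsOfIncrease (F : ℝ → ℝ) : Set ℝ :=
  {x | ∀ ε : ℝ, 0 < ε → F (x - ε) < F (x + ε)}

/-- `π` is determined by its moments: no other Borel probability measure on `ℝ` has (finite
moments and) the same moment sequence. -/
def MomentDeterminate (π : Measure ℝ) : Prop :=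
  ∀ ν : Measure ℝ, IsProbabilityMeasure ν → HasFiniteMoments ν →
    (∀ k : ℕ, ∫ x, x ^ k ∂ν = ∫ x, x ^ k ∂π) → ν = π

/-- `p 0, p 1, …` are the orthonormal polynomials of `π`: `p n` has degree exactly `n`, positive
leading coefficient, and `⟨p n, p m⟩_{L²(π)} = δ_{n m}`. -/
structure IsOrthonormalPolynomials (π : Measure ℝ) (p : ℕ → Polynomial ℝ) : Prop where
  degree_eq : ∀ n, (p n).degree = (n : WithBot ℕ)
  leadingCoeff_pos : ∀ n, 0 < (p n).leadingCoeff
  orthonormal : ∀ n m, ∫ x, (p n).eval x * (p m).eval x ∂π = if n = m then 1 else 0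

/-- Multi-indices `α = (α₀, α₁, α₂, …)`: `α.1` is the index of a basis vector of the output space
and `α.2` is the finitely supported family of polynomial degrees in the input coordinates. -/
abbrev MultiIndex (κ ι : Type*) : Type _ := κ × (ι →₀ ℕ)

/-- The rank-one polynomial operator `P_α(f) = (∏ j, p j (α j) (⟨ξ j, f⟩)) ψ_{α₀}`. The product is
over the support of `α.2`; the remaining factors are `p j 0`, which is the constant `1` for the
orthonormal polynomials of a probability measure. -/
noncomputable def polyOp {ι κ X Y : Type*}
    [NormedAddCommGroup X] [InnerProductSpace ℝ X]
    [NormedAddCommGroup Y] [InnerProductSpace ℝ Y]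
    (ξ : HilbertBasis ι ℝ X) (ψ : HilbertBasis κ ℝ Y) (p : ι → ℕ → Polynomial ℝ)
    (α : MultiIndex κ ι) (f : X) : Y :=
  (α.2.prod fun j n => (p j n).eval (inner ℝ (ξ j) f)) • ψ α.1

/-- An exhaustion of `I` by finite sets: an increasing sequence of finite sets with union `I`. -/
def IsExhaustion {I : Type*} (Λ : ℕ → Finset I) : Prop :=
  Monotone Λ ∧ ∀ a : I, ∃ N : ℕ, a ∈ Λ N

end PolyOperator

/-!
The proof reduces the completeness of the products `P_α` to one dimensional density, and derives the
latter from moment determinacy by the classical argument of M. Riesz.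

*One dimension.* Let `π` be a moment determinate probability measure with finite moments. If a
continuous function `g` of polynomial growth could not be approximated in `L¹(π)` from below by
polynomials, the M. Riesz extension theorem would extend the moment functional to a positive
functional with a smaller value at `g`; this functional is integration against a measure
(`exists_measure_of_positive`) with the same moments as `π`, a contradiction
(`exists_polynomial_le_of_momentDeterminate`). Take `g = 1 / (1 + x²)` and a polynomial `p ≤ g` with
`∫ (g - p) dπ` small. Then `1 - (1 + X²) p` is nonnegative on `ℝ`, hence equal to `|r|²` there for a
complex polynomial `r`, which may be chosen with `|r(i)| ≥ 1` as the value of `1 - (1 + X²) p` at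
`i` is `1`. Writing `r / r(i) = 1 - (X - i) s` gives
`∫ |1 / (x - i) - s|² dπ ≤ ∫ |r|² / (1 + x²) dπ = ∫ (g - p) dπ`,
so `1 / (x - i)` is an `L²`-limit of polynomials (`exists_polynomial_approx_resolvent`). Division by
`X² + 1` shows that the functions orthogonal to all polynomials are stable under multiplication by
the real and imaginary parts of `1 / (x - i)`. These generate a point separating algebra of bounded
continuous functions, so a function orthogonal to all polynomials is zero
(`ae_eq_zero_of_orthogonal_polynomials`) and polynomials are dense (`exists_polynomial_approx`).

*Orthonormal polynomials.* Infinitely many points of increase make `∫ p q dπ` positive definite on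
polynomials; existence and uniqueness follow by projecting `X ^ n` onto the polynomials of lower
degree (`existsUnique_isOrthonormalPolynomials`).

*Products.* By independence, integrals of products of functions of the coordinates factorise, which
gives square integrability and orthonormality. A function orthogonal to all `P_α` has coordinates in
`Y` orthogonal to every product of orthonormal polynomials. One dimensional density allows the
factors to be replaced, one after the other, by arbitrary square integrable functions
(`integral_mul_prod_coord_eq_zero`), in particular by indicators. The cylinder sets form a π-system
generating the Borel σ-algebra, so the function vanishes (`ae_eq_zero_of_orthogonal_polyOp`).
-/

namespace PolyOperator

open MeasureTheory Polynomial Filter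
open scoped CompactlySupported BoundedContinuousFunction

/-! ### Nonnegative real polynomials -/

/-- A real polynomial that is nonnegative on `ℝ` is a sum of two squares. -/
theorem exists_sq_add_sq_of_eval_nonneg (P : ℝ[X]) (hP : ∀ x, 0 ≤ P.eval x) :
    ∃ a b : ℝ[X], P = a ^ 2 + b ^ 2 := by
  induction hn : P.natDegree using Nat.strong_induction_on generalizing P with
  | _ n ih =>
  rcases Nat.eq_zero_or_pos P.natDegree with h0 | hpos
  · obtain ⟨c, rfl⟩ := natDegree_eq_zero.mp h0
    refine ⟨C √c, 0, ?_⟩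
    have hc : 0 ≤ c := by simpa using hP 0
    rw [← C_pow, Real.sq_sqrt hc]
    simp
  have hP0 : P ≠ 0 := by rintro rfl; simp at hpos
  have hdeg : P.degree ≠ 0 := by
    rw [degree_eq_natDegree hP0]
    exact_mod_cast hpos.ne'
  obtain ⟨z, hz⟩ := IsAlgClosed.exists_aeval_eq_zero ℂ P hdeg
  by_cases him : z.im = 0
  · have hzr : z = (z.re : ℂ) := by apply Complex.ext <;> simp [him]
    set r := z.re
    have hr : P.eval r = 0 := by
      rw [hzr] at hz
      have h : ((P.eval r : ℝ) : ℂ) = 0 := by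
        rw [← hz]
        exact (Polynomial.aeval_algebraMap_apply_eq_algebraMap_eval (A := ℂ) r P).symm
      exact_mod_cast h
    obtain ⟨R, hR⟩ := dvd_iff_isRoot.mpr hr
    -- The real root `r` is a minimum of `P`, hence a double root.
    have hmin : IsLocalMin (fun x => P.eval x) r :=
      Filter.Eventually.of_forall fun x => by simpa [hr] using hP x
    have hRr : R.eval r = 0 := by
      have h := hmin.deriv_eq_zero
      rw [Polynomial.deriv, hR] at h
      simpa using h
    obtain ⟨Q, hQ⟩ := dvd_iff_isRoot.mpr hRr
    have hPQ : P = (X - C r) ^ 2 * Q := by rw [hR, hQ]; ring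
    have hQnn : ∀ x, 0 ≤ Q.eval x := by
      have hcl : IsClosed {x : ℝ | 0 ≤ Q.eval x} :=
        isClosed_le continuous_const Q.continuous
      have hsub : ({r}ᶜ : Set ℝ) ⊆ {x : ℝ | 0 ≤ Q.eval x} := by
        intro x hx
        have h := hP x
        rw [hPQ] at h
        simp only [eval_mul, eval_pow, eval_sub, eval_X, eval_C] at h
        have hx' : x - r ≠ 0 := sub_ne_zero.mpr hx
        exact nonneg_of_mul_nonneg_right h (by positivity)
      intro x
      have := hcl.closure_subset_iff.mpr hsub
      rw [(dense_compl_singleton r).closure_eq] at this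
      exact this trivial
    have hQ0 : Q ≠ 0 := by rintro rfl; simp [hPQ] at hP0
    obtain ⟨a, b, hab⟩ := ih Q.natDegree (by
      rw [← hn, hPQ, (((monic_X_sub_C r).pow 2).natDegree_mul' hQ0), natDegree_pow,
        natDegree_X_sub_C]
      lia) Q hQnn rfl
    exact ⟨(X - C r) * a, (X - C r) * b, by rw [hPQ, hab]; ring⟩
  · obtain ⟨Q, hPQ⟩ := quadratic_dvd_of_aeval_eq_zero_im_ne_zero P hz him
    set r := z.re
    set s := z.im
    have hnorm : ‖z‖ ^ 2 = r ^ 2 + s ^ 2 := by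
      rw [← Complex.normSq_eq_norm_sq, Complex.normSq_apply]; ring
    have hq : (X ^ 2 - C (2 * r) * X + C (‖z‖ ^ 2) : ℝ[X]) = (X - C r) ^ 2 + (C s) ^ 2 := by
      rw [hnorm]
      simp only [C_add, C_mul, C_pow]
      rw [show (C 2 : ℝ[X]) = 2 from rfl]
      ring
    rw [hq] at hPQ
    have hQnn : ∀ x, 0 ≤ Q.eval x := by
      intro x
      have h := hP x
      rw [hPQ] at h
      simp only [eval_mul, eval_pow, eval_sub, eval_X, eval_C, eval_add] at h
      exact nonneg_of_mul_nonneg_right h (by positivity)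
    have hQ0 : Q ≠ 0 := by rintro rfl; simp [hPQ] at hP0
    have hmonic : ((X - C r) ^ 2 + (C s) ^ 2 : ℝ[X]).Monic ∧
        ((X - C r) ^ 2 + (C s) ^ 2 : ℝ[X]).natDegree = 2 := by
      have : ((X - C r) ^ 2 + (C s) ^ 2 : ℝ[X]) =
          C 1 * X ^ 2 + C (-2 * r) * X + C (r ^ 2 + s ^ 2) := by
        simp only [C_add, C_mul, C_pow, C_neg, C_1]
        rw [show (C 2 : ℝ[X]) = 2 from rfl]
        ring
      rw [this]
      exact ⟨leadingCoeff_quadratic one_ne_zero, natDegree_quadratic one_ne_zero⟩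
    obtain ⟨a, b, hab⟩ := ih Q.natDegree (by
      rw [← hn, hPQ, hmonic.1.natDegree_mul' hQ0, hmonic.2]
      lia) Q hQnn rfl
    exact ⟨(X - C r) * a - C s * b, (X - C r) * b + C s * a, by rw [hPQ, hab]; ring⟩

/-- Factorisation `P = |r|²` on the real line, normalised at `i`: if a nonnegative polynomial `P`
satisfies `P(i) = 1`, then there is a complex polynomial `A + iB` with `(A + iB)(i) = 1` and
`|A + iB|² ≤ P` on `ℝ`. The conclusion records the real and imaginary parts of
`(x + i) (A + iB) = (xA - B) + i (A + xB)` modulo `X² + 1`. -/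
theorem exists_resolvent_factor (P : ℝ[X]) (hP : ∀ x, 0 ≤ P.eval x)
    (hI : aeval Complex.I P = 1) :
    ∃ A B u v : ℝ[X], (∀ x, A.eval x ^ 2 + B.eval x ^ 2 ≤ P.eval x) ∧
      X * A - B = X - (X ^ 2 + 1) * u ∧ A + X * B = 1 - (X ^ 2 + 1) * v := by
  -- The quotient polynomials come from divisibility by the minimal polynomial of `i`.
  have key : ∀ A B : ℝ[X], aeval Complex.I A + Complex.I * aeval Complex.I B = 1 →
      ∃ u v : ℝ[X], X * A - B = X - (X ^ 2 + 1) * u ∧ A + X * B = 1 - (X ^ 2 + 1) * v := by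
    intro A B h
    have hdvd : ∀ Q : ℝ[X], aeval Complex.I Q = 0 → (X ^ 2 + 1 : ℝ[X]) ∣ Q := by
      intro Q hQ
      simpa using quadratic_dvd_of_aeval_eq_zero_im_ne_zero Q hQ (by simp)
    obtain ⟨u, hu⟩ := hdvd (X - (X * A - B)) (by
      simp only [map_sub, map_mul, aeval_X]
      linear_combination -Complex.I * h + aeval Complex.I B * Complex.I_sq)
    obtain ⟨v, hv⟩ := hdvd (1 - (A + X * B)) (by
      simp only [map_sub, map_mul, aeval_X, map_add, map_one]
      linear_combination -h)
    exact ⟨u, v, by rw [← hu]; ring, by rw [← hv]; ring⟩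
  -- The factor can be chosen with `1 ≤ |r(i)|`, by passing to the conjugate if necessary.
  obtain ⟨a, b, hPab, hr⟩ : ∃ a b : ℝ[X], P = a ^ 2 + b ^ 2 ∧
      1 ≤ ‖aeval Complex.I a + Complex.I * aeval Complex.I b‖ := by
    obtain ⟨a, b, hab⟩ := exists_sq_add_sq_of_eval_nonneg P hP
    have hprod : (aeval Complex.I a + Complex.I * aeval Complex.I b) *
        (aeval Complex.I a + Complex.I * aeval Complex.I (-b)) = 1 := by
      rw [← hI, hab]
      simp only [map_add, map_pow, map_neg]
      linear_combination -(aeval Complex.I b) ^ 2 * Complex.I_sq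
    by_contra! hcon
    have h1 := hcon a b hab
    have h2 := hcon a (-b) (by rw [hab]; ring)
    have h3 := congrArg norm hprod
    rw [norm_mul, norm_one] at h3
    exact (mul_lt_one_of_nonneg_of_lt_one_left (norm_nonneg _) h1 h2.le).ne h3
  set w := aeval Complex.I a + Complex.I * aeval Complex.I b with hw
  have hw0 : w ≠ 0 := by
    rw [← norm_pos_iff]; linarith
  set c := w⁻¹ with hc
  have hcn : c.re ^ 2 + c.im ^ 2 ≤ 1 := by
    have h1 : ‖c‖ ≤ 1 := by rw [hc, norm_inv]; exact inv_le_one_of_one_le₀ hr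
    have h2 : ‖c‖ ^ 2 = c.re ^ 2 + c.im ^ 2 := by
      rw [← Complex.normSq_eq_norm_sq, Complex.normSq_apply]; ring
    rw [← h2]
    exact pow_le_one₀ (norm_nonneg _) h1
  obtain ⟨u, v, hu, hv⟩ := key (C c.re * a - C c.im * b) (C c.im * a + C c.re * b) (by
    have hcw : c * w = 1 := inv_mul_cancel₀ hw0
    have hcc : c = c.re + c.im * Complex.I := (Complex.re_add_im c).symm
    simp only [map_sub, map_add, map_mul, aeval_C, Complex.coe_algebraMap]
    rw [← hcw, hw]
    nth_rewrite 5 [hcc]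
    linear_combination -(c.im : ℂ) * aeval Complex.I b * Complex.I_sq)
  refine ⟨_, _, u, v, fun x => ?_, hu, hv⟩
  rw [hPab]
  simp only [eval_sub, eval_add, eval_mul, eval_C, eval_pow]
  nlinarith [mul_nonneg (sub_nonneg.mpr hcn)
    (add_nonneg (sq_nonneg (a.eval x)) (sq_nonneg (b.eval x)))]

/-! ### Positive functionals on functions of polynomial growth -/

/-- The continuous real functions of at most polynomial growth. -/
def polyGrowth : Submodule ℝ (ℝ → ℝ) where
  carrier := {F | Continuous F ∧ ∃ C : ℝ, 0 ≤ C ∧ ∃ k : ℕ, ∀ x, |F x| ≤ C * (1 + x ^ 2) ^ k}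
  zero_mem' := ⟨continuous_const, 0, le_rfl, 0, by simp⟩
  add_mem' := by
    rintro F G ⟨hF, C, hC, k, hk⟩ ⟨hG, D, hD, l, hl⟩
    refine ⟨hF.add hG, C + D, by positivity, max k l, fun x => ?_⟩
    have h1 : (1 : ℝ) ≤ 1 + x ^ 2 := by nlinarith [sq_nonneg x]
    calc |F x + G x| ≤ |F x| + |G x| := abs_add_le _ _
      _ ≤ C * (1 + x ^ 2) ^ k + D * (1 + x ^ 2) ^ l := add_le_add (hk x) (hl x)
      _ ≤ C * (1 + x ^ 2) ^ max k l + D * (1 + x ^ 2) ^ max k l := by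
        gcongr
        · exact le_max_left _ _
        · exact le_max_right _ _
      _ = (C + D) * (1 + x ^ 2) ^ max k l := by ring
  smul_mem' := by
    rintro c F ⟨hF, C, hC, k, hk⟩
    refine ⟨hF.const_smul c, |c| * C, by positivity, k, fun x => ?_⟩
    calc |c * F x| = |c| * |F x| := abs_mul _ _
      _ ≤ |c| * (C * (1 + x ^ 2) ^ k) := by gcongr; exact hk x
      _ = |c| * C * (1 + x ^ 2) ^ k := by ring

theorem polyGrowth_of_bounded {F : ℝ → ℝ} (hF : Continuous F) {C : ℝ} (hC : ∀ x, |F x| ≤ C) :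
    F ∈ polyGrowth :=
  ⟨hF, C, (abs_nonneg _).trans (hC 0), 0, by simpa using hC⟩

theorem polyGrowth_mul {F G : ℝ → ℝ} (hF : F ∈ polyGrowth) (hG : G ∈ polyGrowth) :
    (fun x => F x * G x) ∈ polyGrowth := by
  obtain ⟨hF, C, hC, k, hk⟩ := hF
  obtain ⟨hG, D, hD, l, hl⟩ := hG
  refine ⟨hF.mul hG, C * D, by positivity, k + l, fun x => ?_⟩
  calc |F x * G x| = |F x| * |G x| := abs_mul _ _
    _ ≤ (C * (1 + x ^ 2) ^ k) * (D * (1 + x ^ 2) ^ l) :=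
      mul_le_mul (hk x) (hl x) (abs_nonneg _) (by positivity)
    _ = C * D * (1 + x ^ 2) ^ (k + l) := by ring

theorem polyGrowth_abs {F : ℝ → ℝ} (hF : F ∈ polyGrowth) : (fun x => |F x|) ∈ polyGrowth := by
  obtain ⟨hF, C, hC, k, hk⟩ := hF
  exact ⟨hF.abs, C, hC, k, by simpa using hk⟩

theorem eval_mem_polyGrowth (p : ℝ[X]) : (fun x => p.eval x) ∈ polyGrowth := by
  induction p using Polynomial.induction_on' with
  | add p q hp hq =>
    simp only [eval_add]
    exact polyGrowth.add_mem hp hq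
  | monomial n a =>
    have hX : (fun x : ℝ => x) ∈ polyGrowth := by
      refine ⟨continuous_id, 1, zero_le_one, 1, fun x => ?_⟩
      rw [one_mul, pow_one, abs_le]
      constructor <;> nlinarith [sq_nonneg (x - 1), sq_nonneg (x + 1)]
    have hpow : (fun x : ℝ => x ^ n) ∈ polyGrowth := by
      induction n with
      | zero => exact polyGrowth_of_bounded (C := 1) (by fun_prop) (by simp)
      | succ n ih => simpa [pow_succ] using polyGrowth_mul ih hX
    simp only [eval_monomial]
    exact polyGrowth.smul_mem a hpow

theorem integrable_eval {π : Measure ℝ} (hmom : HasFiniteMoments π) (p : ℝ[X]) :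
    Integrable (fun x => p.eval x) π := by
  simp_rw [eval_eq_sum_range]
  exact integrable_finsetSum _ fun k _ => (hmom k).const_mul _

theorem integrable_of_mem_polyGrowth {π : Measure ℝ} (hmom : HasFiniteMoments π) {F : ℝ → ℝ}
    (hF : F ∈ polyGrowth) : Integrable F π := by
  obtain ⟨hF, D, hD, k, hk⟩ := hF
  refine (integrable_eval hmom (C D * (1 + X ^ 2) ^ k : ℝ[X])).mono' hF.aestronglyMeasurable ?_
  exact .of_forall fun x => by simpa using hk x

/-- A positive linear functional on the continuous functions of polynomial growth is integration
against a measure. The Riesz–Markov–Kakutani theorem gives the measure on compactly supported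
functions; multiplying by `1 + x²` shows that no mass escapes to infinity. -/
theorem exists_measure_of_positive (Λ : polyGrowth →ₗ[ℝ] ℝ)
    (hΛ : ∀ F : polyGrowth, (∀ x, 0 ≤ (F : ℝ → ℝ) x) → 0 ≤ Λ F) :
    ∃ ν : Measure ℝ, ∀ F : polyGrowth, Integrable (F : ℝ → ℝ) ν ∧
      ∫ x, (F : ℝ → ℝ) x ∂ν = Λ F := by
  have hmono : ∀ F G : polyGrowth, (∀ x, (F : ℝ → ℝ) x ≤ (G : ℝ → ℝ) x) → Λ F ≤ Λ G := by
    intro F G h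
    have := hΛ (G - F) fun x => by simpa using h x
    rw [map_sub] at this
    linarith
  have hcc : ∀ f : C_c(ℝ, ℝ), (f : ℝ → ℝ) ∈ polyGrowth := by
    intro f
    obtain ⟨C, hC⟩ := f.hasCompactSupport.exists_bound_of_continuous f.continuous
    exact polyGrowth_of_bounded f.continuous hC
  let L : C_c(ℝ, ℝ) →ₗ[ℝ] ℝ :=
    { toFun := fun f => Λ ⟨f, hcc f⟩
      map_add' := fun f g => by rw [← map_add]; rfl
      map_smul' := fun c f => by rw [← map_smul]; rfl }
  let L' : C_c(ℝ, ℝ) →ₚ[ℝ] ℝ := PositiveLinearMap.mk₀ L fun f hf => hΛ _ fun x => hf x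
  let ν := RealRMK.rieszMeasure L'
  have hν : ∀ f : C_c(ℝ, ℝ), ∫ x, f x ∂ν = Λ ⟨f, hcc f⟩ := fun f =>
    RealRMK.integral_rieszMeasure L' f
  refine ⟨ν, ?_⟩
  -- Compactly supported cutoffs with `1 - χ n x ≤ (1 + x²) / (n + 1)`.
  let χ : ℕ → ℝ → ℝ := fun n x => max 0 (1 - |x| / (n + 1))
  have hχc : ∀ n, Continuous (χ n) := fun n => by fun_prop
  have hχ0 : ∀ n x, 0 ≤ χ n x := fun n x => le_max_left _ _
  have hχ1 : ∀ n x, χ n x ≤ 1 := fun n x =>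
    max_le zero_le_one (sub_le_self _ (by positivity))
  have hχ2 : ∀ n x, 1 - χ n x ≤ (1 + x ^ 2) / (n + 1) := by
    intro n x
    have h1 : 1 - |x| / (n + 1) ≤ χ n x := le_max_right _ _
    have h2 : |x| / ((n : ℝ) + 1) ≤ (1 + x ^ 2) / (n + 1) := by
      gcongr
      nlinarith [sq_nonneg (|x| - 1), sq_abs x, abs_nonneg x]
    linarith
  have hχs : ∀ n, HasCompactSupport (χ n) := by
    intro n
    refine HasCompactSupport.intro (isCompact_closedBall (0 : ℝ) (n + 1)) fun x hx => ?_
    have h1 : (n : ℝ) + 1 < |x| := by simpa using hx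
    have h2 : 1 ≤ |x| / ((n : ℝ) + 1) := by
      rw [le_div_iff₀ (by positivity)]; linarith
    exact max_eq_left (by linarith)
  let cut : ℕ → polyGrowth → C_c(ℝ, ℝ) := fun n F =>
    ⟨⟨fun x => χ n x * (F : ℝ → ℝ) x, (hχc n).mul F.2.1⟩, (hχs n).mul_right⟩
  have hcut : ∀ n F x, cut n F x = χ n x * (F : ℝ → ℝ) x := fun n F x => rfl
  have hχt : ∀ x, Tendsto (fun n => χ n x) atTop (nhds 1) := by
    intro x
    have hlim : Tendsto (fun n : ℕ => 1 - (1 + x ^ 2) / ((n : ℝ) + 1)) atTop (nhds (1 - 0)) :=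
      tendsto_const_nhds.sub
        (tendsto_const_nhds.div_atTop (tendsto_natCast_atTop_atTop.atTop_add tendsto_const_nhds))
    rw [sub_zero] at hlim
    exact tendsto_of_tendsto_of_tendsto_of_le_of_le hlim tendsto_const_nhds
      (fun n => by have := hχ2 n x; linarith) (fun n => hχ1 n x)
  have hΛlim : ∀ F : polyGrowth,
      Tendsto (fun n => Λ ⟨cut n F, hcc _⟩) atTop (nhds (Λ F)) := by
    intro F
    -- The error is at most `(1 + x²) |F| / (n + 1)`, again a function of polynomial growth.
    let q : polyGrowth := ⟨_, polyGrowth_mul (eval_mem_polyGrowth (1 + X ^ 2))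
      (polyGrowth_abs F.2)⟩
    have hb : ∀ n, |Λ ⟨cut n F, hcc _⟩ - Λ F| ≤ Λ q / ((n : ℝ) + 1) := by
      intro n
      have hpt : ∀ x, |χ n x * (F : ℝ → ℝ) x - (F : ℝ → ℝ) x| ≤
          ((n : ℝ) + 1)⁻¹ * ((1 + x ^ 2) * |(F : ℝ → ℝ) x|) := by
        intro x
        rw [show χ n x * (F : ℝ → ℝ) x - (F : ℝ → ℝ) x =
          -((1 - χ n x) * (F : ℝ → ℝ) x) by ring, abs_neg, abs_mul,
          abs_of_nonneg (by linarith [hχ1 n x])]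
        calc _ ≤ ((1 + x ^ 2) / (n + 1)) * |(F : ℝ → ℝ) x| := by gcongr; exact hχ2 n x
          _ = _ := by ring
      rw [← map_sub, div_eq_inv_mul, ← smul_eq_mul, ← map_smul, abs_le, ← map_neg]
      constructor
      · refine hmono _ _ fun x => ?_
        have := (abs_le.mp (hpt x)).1
        simpa [q, hcut] using this
      · refine hmono _ _ fun x => ?_
        have := (abs_le.mp (hpt x)).2
        simpa [q, hcut] using this
    rw [tendsto_iff_norm_sub_tendsto_zero]
    exact squeeze_zero (fun n => norm_nonneg _) hb
      (tendsto_const_nhds.div_atTop (tendsto_natCast_atTop_atTop.atTop_add tendsto_const_nhds))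
  have hint : ∀ F : polyGrowth, Integrable (F : ℝ → ℝ) ν := by
    intro F
    let G : polyGrowth := ⟨_, polyGrowth_abs F.2⟩
    refine ⟨F.2.1.aestronglyMeasurable, ?_⟩
    have hle : ∀ n, ∫⁻ x, ‖cut n F x‖ₑ ∂ν ≤ ENNReal.ofReal (Λ G) := by
      intro n
      have h1 : ∫⁻ x, ‖cut n F x‖ₑ ∂ν = ENNReal.ofReal (∫ x, cut n G x ∂ν) := by
        rw [ofReal_integral_eq_lintegral_ofReal (f := fun x => cut n G x)
          ((cut n G).continuous.integrable_of_hasCompactSupport (cut n G).hasCompactSupport)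
          (.of_forall fun x => mul_nonneg (hχ0 n x) (abs_nonneg _))]
        refine lintegral_congr fun x => ?_
        rw [hcut, hcut, ← ofReal_norm, norm_mul, Real.norm_of_nonneg (hχ0 n x)]
        rfl
      rw [h1, hν]
      refine ENNReal.ofReal_le_ofReal (hmono _ _ fun x => ?_)
      exact mul_le_of_le_one_left (abs_nonneg _) (hχ1 n x)
    have hfat : ∫⁻ x, ‖(F : ℝ → ℝ) x‖ₑ ∂ν ≤
        liminf (fun n => ∫⁻ x, ‖cut n F x‖ₑ ∂ν) atTop := by
      refine le_trans (le_of_eq ?_) (lintegral_liminf_le fun n =>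
        ((cut n F).continuous.enorm).measurable)
      refine lintegral_congr fun x => ?_
      have ht : Tendsto (fun n => cut n F x) atTop (nhds ((F : ℝ → ℝ) x)) := by
        simpa [hcut] using (hχt x).mul_const ((F : ℝ → ℝ) x)
      exact (ht.enorm.liminf_eq).symm
    refine lt_of_le_of_lt (hfat.trans ?_) ENNReal.ofReal_lt_top (b := ENNReal.ofReal (Λ G))
    exact (liminf_le_liminf (.of_forall hle)).trans (by simp)
  refine fun F => ⟨hint F, tendsto_nhds_unique ?_ (hΛlim F)⟩
  simp_rw [← hν]
  refine tendsto_integral_of_dominated_convergence (fun x => |(F : ℝ → ℝ) x|)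
    (fun n => (cut n F).continuous.aestronglyMeasurable) (hint F).abs
    (fun n => .of_forall fun x => ?_) (.of_forall fun x => ?_)
  · rw [hcut, norm_mul, Real.norm_of_nonneg (hχ0 n x)]
    exact mul_le_of_le_one_left (norm_nonneg _) (hχ1 n x)
  · simpa [hcut] using (hχt x).mul_const ((F : ℝ → ℝ) x)

/-- For a moment determinate measure, every continuous function `g` of polynomial growth can be
approximated in mean from below by polynomials. Otherwise the M. Riesz extension theorem extends
the moment functional to a positive functional with a smaller value at `g`, and the measure
representing this extension has the same moments. -/
theorem exists_polynomial_le_of_momentDeterminate {π : Measure ℝ} [IsProbabilityMeasure π]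
    (hmom : HasFiniteMoments π) (hdet : MomentDeterminate π) {g : ℝ → ℝ} (hg : g ∈ polyGrowth)
    {ε : ℝ} (hε : 0 < ε) :
    ∃ p : ℝ[X], (∀ x, p.eval x ≤ g x) ∧ ∫ x, (g x - p.eval x) ∂π < ε := by
  by_contra! hcon
  have hgi := integrable_of_mem_polyGrowth hmom hg
  set c : ℝ := ∫ x, g x ∂π - ε with hc
  have hle : ∀ p : ℝ[X], (∀ x, p.eval x ≤ g x) → ∫ x, p.eval x ∂π ≤ c := by
    intro p hp
    have := hcon p hp
    rw [integral_sub hgi (integrable_eval hmom p)] at this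
    linarith
  -- Positivity on this cone forces the value at `g` to be at most `c`.
  let s : PointedCone ℝ polyGrowth :=
    { carrier := {F | ∃ t : ℝ, 0 ≤ t ∧ ∀ x, t * (c - g x) ≤ (F : ℝ → ℝ) x}
      zero_mem' := ⟨0, le_rfl, by simp⟩
      add_mem' := by
        rintro F G ⟨t, ht, hF⟩ ⟨u, hu, hG⟩
        refine ⟨t + u, by positivity, fun x => ?_⟩
        rw [add_mul]
        exact add_le_add (hF x) (hG x)
      smul_mem' := by
        rintro a F ⟨t, ht, hF⟩
        refine ⟨a * t, mul_nonneg a.2 ht, fun x => ?_⟩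
        rw [mul_assoc]
        exact mul_le_mul_of_nonneg_left (hF x) a.2 }
  let I : polyGrowth →ₗ[ℝ] ℝ :=
    { toFun := fun F => ∫ x, (F : ℝ → ℝ) x ∂π
      map_add' := fun F G => integral_add (integrable_of_mem_polyGrowth hmom F.2)
        (integrable_of_mem_polyGrowth hmom G.2)
      map_smul' := fun a F => integral_const_mul a _ }
  let ev : ℝ[X] →ₗ[ℝ] polyGrowth :=
    { toFun := fun p => ⟨_, eval_mem_polyGrowth p⟩
      map_add' := fun p q => by ext x; simp
      map_smul' := fun a p => by ext x; simp }
  let f : polyGrowth →ₗ.[ℝ] ℝ := ⟨LinearMap.range ev, I.domRestrict _⟩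
  obtain ⟨Λ, hΛf, hΛs⟩ := riesz_extension s f (by
    rintro ⟨_, p, rfl⟩ ⟨t, ht, hp⟩
    change 0 ≤ ∫ x, p.eval x ∂π
    replace hp : ∀ x, t * (c - g x) ≤ p.eval x := hp
    rcases ht.eq_or_lt with rfl | ht
    · exact integral_nonneg fun x => by simpa using hp x
    · have h := hle (C c - C t⁻¹ * p) fun x => by
        have h1 := mul_le_mul_of_nonneg_left (hp x) (inv_nonneg.mpr ht.le)
        rw [inv_mul_cancel_left₀ ht.ne'] at h1
        simp only [eval_sub, eval_mul, eval_C]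
        linarith
      simp only [eval_sub, eval_mul, eval_C] at h
      rw [integral_sub (integrable_const _) ((integrable_eval hmom p).const_mul _),
        integral_const_mul] at h
      simp only [integral_const, probReal_univ, one_smul, sub_le_self_iff] at h
      exact nonneg_of_mul_nonneg_right h (inv_pos.mpr ht)) (by
    rintro ⟨F, hF, D, hD, k, hk⟩
    refine ⟨⟨ev (C D * (1 + X ^ 2) ^ k), _, rfl⟩, 0, le_rfl, fun x => ?_⟩
    have h := (abs_le.mp (hk x)).1
    simp only [zero_mul]
    change 0 ≤ (C D * (1 + X ^ 2) ^ k : ℝ[X]).eval x + F x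
    simp only [eval_mul, eval_C, eval_pow, eval_add, eval_one, eval_X]
    linarith)
  have hΛev : ∀ p : ℝ[X], Λ (ev p) = ∫ x, p.eval x ∂π := fun p => hΛf ⟨ev p, p, rfl⟩
  have hΛg : Λ ⟨g, hg⟩ ≤ c := by
    have h := hΛs (ev (C c) - ⟨g, hg⟩) ⟨1, zero_le_one, fun x => by
      change 1 * (c - g x) ≤ (C c : ℝ[X]).eval x - g x
      simp⟩
    rw [map_sub, hΛev] at h
    simp only [eval_C, integral_const, probReal_univ, one_smul] at h
    linarith
  obtain ⟨ν, hν⟩ := exists_measure_of_positive Λ fun F hF => hΛs F ⟨0, le_rfl, by simpa using hF⟩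
  have hν1 : ν = π := by
    have hν0 := hν (ev 1)
    have hint1 : Integrable (fun _ : ℝ => (1 : ℝ)) ν := by
      convert hν0.1 using 2
      simp [ev]
    have : IsFiniteMeasure ν := (integrable_const_iff.mp hint1).resolve_left one_ne_zero
    have hpow : ∀ k : ℕ, Integrable (fun x : ℝ => x ^ k) ν ∧
        ∫ x, x ^ k ∂ν = ∫ x, x ^ k ∂π := by
      intro k
      have h := hν (ev (X ^ k))
      rw [hΛev] at h
      simpa [ev] using h
    refine hdet ν ⟨?_⟩ (fun k => (hpow k).1) fun k => (hpow k).2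
    have h := (hpow 0).2
    simp only [pow_zero, integral_const, probReal_univ, smul_eq_mul, mul_one] at h
    rw [← ENNReal.toReal_eq_one_iff]
    exact h
  have h := (hν ⟨g, hg⟩).2
  rw [hν1] at h
  change ∫ x, g x ∂π = _ at h
  linarith

/-! ### Density of polynomials in `L²` of a moment determinate measure -/

theorem sq_integral_mul_le {Ω : Type*} [MeasurableSpace Ω] {μ : Measure Ω} {f g : Ω → ℝ}
    (hf : MemLp f 2 μ) (hg : MemLp g 2 μ) :
    (∫ x, f x * g x ∂μ) ^ 2 ≤ (∫ x, f x ^ 2 ∂μ) * ∫ x, g x ^ 2 ∂μ := by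
  have key : ∀ {u v : Ω → ℝ} (hu : MemLp u 2 μ) (hv : MemLp v 2 μ),
      inner ℝ (hu.toLp u) (hv.toLp v) = ∫ x, u x * v x ∂μ := by
    intro u v hu hv
    rw [L2.inner_def]
    refine integral_congr_ae ?_
    filter_upwards [hu.coeFn_toLp, hv.coeFn_toLp] with x h1 h2
    rw [h1, h2, real_inner_comm]
    rfl
  have h := real_inner_mul_inner_self_le (hf.toLp f) (hg.toLp g)
  rw [key, key, key] at h
  simpa only [sq] using h

/-- Orthogonality passes to `L²` limits. -/
theorem integral_mul_eq_zero_of_approx {Ω : Type*} [MeasurableSpace Ω] {μ : Measure Ω}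
    {h g : Ω → ℝ} (hh : MemLp h 2 μ) (hg : MemLp g 2 μ)
    (happ : ∀ ε : ℝ, 0 < ε → ∃ q : Ω → ℝ, MemLp q 2 μ ∧ ∫ x, h x * q x ∂μ = 0 ∧
      ∫ x, (g x - q x) ^ 2 ∂μ ≤ ε) :
    ∫ x, h x * g x ∂μ = 0 := by
  by_contra hne
  have hpos : 0 < (∫ x, h x * g x ∂μ) ^ 2 := by positivity
  have hn : 0 ≤ ∫ x, h x ^ 2 ∂μ := integral_nonneg fun x => sq_nonneg _
  obtain ⟨q, hq, hq0, hqε⟩ := happ ((∫ x, h x * g x ∂μ) ^ 2 / (2 * (∫ x, h x ^ 2 ∂μ + 1)))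
    (by positivity)
  have h1 := sq_integral_mul_le hh (hg.sub hq)
  have h2 : ∫ x, h x * (g - q) x ∂μ = ∫ x, h x * g x ∂μ := by
    simp only [Pi.sub_apply, mul_sub]
    have i1 : Integrable (fun x => h x * g x) μ := hh.integrable_mul hg
    have i2 : Integrable (fun x => h x * q x) μ := hh.integrable_mul hq
    rw [integral_sub i1 i2, hq0, sub_zero]
  rw [h2] at h1
  simp only [Pi.sub_apply] at h1
  have h3 := mul_le_mul_of_nonneg_left hqε hn
  set a := (∫ x, h x * g x ∂μ) ^ 2
  set b := ∫ x, h x ^ 2 ∂μ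
  have h4 : b * (a / (2 * (b + 1))) < a := by
    rw [mul_div_assoc', div_lt_iff₀ (by positivity)]
    nlinarith [mul_nonneg hn hpos.le]
  linarith

theorem memLp_two_eval {π : Measure ℝ} (hmom : HasFiniteMoments π) (p : ℝ[X]) :
    MemLp (fun x => p.eval x) 2 π := by
  rw [memLp_two_iff_integrable_sq p.continuous.aestronglyMeasurable]
  refine (integrable_eval hmom (p ^ 2)).congr (.of_forall fun x => ?_)
  exact eval_pow 2

/-- For a moment determinate measure, the real and imaginary parts `x / (1 + x²)` and
`1 / (1 + x²)` of the resolvent function `1 / (x - i)` are `L²`-limits of polynomials. -/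
theorem exists_polynomial_approx_resolvent {π : Measure ℝ} [IsProbabilityMeasure π]
    (hmom : HasFiniteMoments π) (hdet : MomentDeterminate π) {ε : ℝ} (hε : 0 < ε) :
    ∃ u v : ℝ[X], ∫ x, (x / (1 + x ^ 2) - u.eval x) ^ 2 ∂π ≤ ε ∧
      ∫ x, (1 / (1 + x ^ 2) - v.eval x) ^ 2 ∂π ≤ ε := by
  have hpos : ∀ x : ℝ, 0 < 1 + x ^ 2 := fun x => by positivity
  have hg : (fun x : ℝ => 1 / (1 + x ^ 2)) ∈ polyGrowth := by
    refine polyGrowth_of_bounded (C := 1)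
      (continuous_const.div (by fun_prop) fun x => (hpos x).ne') fun x => ?_
    rw [abs_of_nonneg (by positivity), div_le_one (hpos x)]
    nlinarith [sq_nonneg x]
  obtain ⟨p, hp, hpε⟩ := exists_polynomial_le_of_momentDeterminate hmom hdet hg hε
  have hP : ∀ x, (1 - (1 + X ^ 2) * p : ℝ[X]).eval x =
      (1 + x ^ 2) * (1 / (1 + x ^ 2) - p.eval x) := by
    intro x
    have := (hpos x).ne'
    simp only [eval_sub, eval_one, eval_mul, eval_add, eval_pow, eval_X]
    field_simp
  obtain ⟨A, B, u, v, hAB, hu, hv⟩ := exists_resolvent_factor (1 - (1 + X ^ 2) * p)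
    (fun x => by
      rw [hP]
      exact mul_nonneg (hpos x).le (sub_nonneg.mpr (hp x))) (by simp)
  have hi : Integrable (fun x => 1 / (1 + x ^ 2) - p.eval x) π :=
    (integrable_of_mem_polyGrowth hmom hg).sub (integrable_eval hmom p)
  have hsum : ∀ x, (x / (1 + x ^ 2) - u.eval x) ^ 2 + (1 / (1 + x ^ 2) - v.eval x) ^ 2 ≤
      1 / (1 + x ^ 2) - p.eval x := by
    intro x
    have h0 := (hpos x).ne'
    have hux := congrArg (eval x) hu
    have hvx := congrArg (eval x) hv
    simp only [eval_sub, eval_one, eval_mul, eval_add, eval_pow, eval_X] at hux hvx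
    have hu' : x / (1 + x ^ 2) - u.eval x = (x * A.eval x - B.eval x) / (1 + x ^ 2) := by
      rw [eq_div_iff h0, sub_mul, div_mul_cancel₀ _ h0]
      linarith
    have hv' : 1 / (1 + x ^ 2) - v.eval x = (A.eval x + x * B.eval x) / (1 + x ^ 2) := by
      rw [eq_div_iff h0, sub_mul, div_mul_cancel₀ _ h0]
      linarith
    have h := hAB x
    rw [hP, mul_comm, ← div_le_iff₀ (hpos x)] at h
    calc _ = (A.eval x ^ 2 + B.eval x ^ 2) / (1 + x ^ 2) := by
          rw [hu', hv']; field_simp; ring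
      _ ≤ _ := h
  refine ⟨u, v, ?_, ?_⟩
  · refine (integral_mono_of_nonneg (.of_forall fun x => sq_nonneg _) hi
      (.of_forall fun x => ?_)).trans hpε.le
    exact (le_add_of_nonneg_right (sq_nonneg _)).trans (hsum x)
  · refine (integral_mono_of_nonneg (.of_forall fun x => sq_nonneg _) hi
      (.of_forall fun x => ?_)).trans hpε.le
    exact (le_add_of_nonneg_left (sq_nonneg _)).trans (hsum x)

/-- The bounded continuous function `1 / (1 + x²)`. -/
noncomputable def resolventIm : ℝ →ᵇ ℝ :=
  BoundedContinuousFunction.ofNormedAddCommGroup (fun x : ℝ => 1 / (1 + x ^ 2))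
    (continuous_const.div (by fun_prop) fun x => by positivity) 1 fun x => by
      rw [Real.norm_of_nonneg (by positivity), div_le_one (by positivity)]
      nlinarith [sq_nonneg x]

/-- The bounded continuous function `x / (1 + x²)`. -/
noncomputable def resolventRe : ℝ →ᵇ ℝ :=
  BoundedContinuousFunction.ofNormedAddCommGroup (fun x : ℝ => x / (1 + x ^ 2))
    (continuous_id.div (by fun_prop) fun x => by positivity) 1 fun x => by
      rw [Real.norm_eq_abs, abs_div, abs_of_pos (show (0 : ℝ) < 1 + x ^ 2 by positivity),
        div_le_one (by positivity), abs_le]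
      constructor <;> nlinarith [sq_nonneg (x - 1), sq_nonneg (x + 1)]

theorem memLp_mul_bounded {π : Measure ℝ} [IsProbabilityMeasure π] {h : ℝ → ℝ}
    (hh : MemLp h 2 π) (F : ℝ →ᵇ ℝ) : MemLp (fun x => h x * F x) 2 π := by
  have hF : MemLp (F : ℝ → ℝ) ⊤ π :=
    memLp_top_of_bound F.continuous.aestronglyMeasurable ‖F‖
      (.of_forall fun x => F.norm_coe_le_norm x)
  exact hF.mul (r := 2) hh

/-- In `L²` of a moment determinate measure, only zero is orthogonal to all polynomials. The
functions orthogonal to the polynomials are stable under multiplication by the real and imaginary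
parts of `1 / (x - i)`, and the algebra generated by these separates finite measures. -/
theorem ae_eq_zero_of_orthogonal_polynomials {π : Measure ℝ} [IsProbabilityMeasure π]
    (hmom : HasFiniteMoments π) (hdet : MomentDeterminate π) {h : ℝ → ℝ} (hh : MemLp h 2 π)
    (horth : ∀ p : ℝ[X], ∫ x, h x * p.eval x ∂π = 0) : h =ᵐ[π] 0 := by
  let N : Set (ℝ → ℝ) := {h | MemLp h 2 π ∧ ∀ p : ℝ[X], ∫ x, h x * p.eval x ∂π = 0}
  have hbase : ∀ k ∈ N, ∫ x, k x * resolventRe x ∂π = 0 ∧ ∫ x, k x * resolventIm x ∂π = 0 := by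
    rintro k ⟨hk, hk0⟩
    have hb : ∀ F : ℝ →ᵇ ℝ, MemLp (F : ℝ → ℝ) 2 π := fun F => by
      simpa using memLp_mul_bounded (memLp_const 1) F
    constructor
    · refine integral_mul_eq_zero_of_approx hk (hb _) fun ε hε => ?_
      obtain ⟨u, v, hu, hv⟩ := exists_polynomial_approx_resolvent hmom hdet hε
      exact ⟨fun x => u.eval x, memLp_two_eval hmom u, hk0 u, hu⟩
    · refine integral_mul_eq_zero_of_approx hk (hb _) fun ε hε => ?_
      obtain ⟨u, v, hu, hv⟩ := exists_polynomial_approx_resolvent hmom hdet hε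
      exact ⟨fun x => v.eval x, memLp_two_eval hmom v, hk0 v, hv⟩
  have hIm : ∀ k ∈ N, (fun x => k x * resolventIm x) ∈ N := by
    rintro k hk
    refine ⟨memLp_mul_bounded hk.1 _, fun p => ?_⟩
    -- Division by `X² + 1` leaves a linear remainder.
    have hm : (X ^ 2 + 1 : ℝ[X]).Monic := by monicity!
    have hdeg : (p %ₘ (X ^ 2 + 1)).degree < 2 := by
      refine (degree_modByMonic_lt p hm).trans_le ?_
      compute_degree
    obtain ⟨a, b, hab⟩ := exists_eq_X_add_C_of_natDegree_le_one
      (p := p %ₘ (X ^ 2 + 1)) (natDegree_le_of_degree_le (Order.le_of_lt_succ hdeg))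
    have hp := modByMonic_add_div p (X ^ 2 + 1 : ℝ[X])
    rw [hab] at hp
    set s := p /ₘ (X ^ 2 + 1)
    have hpt : ∀ x, k x * resolventIm x * p.eval x =
        k x * s.eval x + (a * (k x * resolventRe x) + b * (k x * resolventIm x)) := by
      intro x
      have hx : (1 + x ^ 2 : ℝ) ≠ 0 := by positivity
      rw [← hp]
      change k x * (1 / (1 + x ^ 2)) * _ =
        _ + (a * (k x * (x / (1 + x ^ 2))) + b * (k x * (1 / (1 + x ^ 2))))
      simp only [eval_add, eval_mul, eval_C, eval_X, eval_pow, eval_one]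
      field_simp
      ring
    have i1 : Integrable (fun x => k x * s.eval x) π :=
      hk.1.integrable_mul (memLp_two_eval hmom s)
    have i2 : ∀ F : ℝ →ᵇ ℝ, Integrable (fun x => k x * F x) π := fun F =>
      (memLp_mul_bounded hk.1 F).integrable one_le_two
    simp_rw [hpt]
    have i3 : Integrable (fun x => a * (k x * resolventRe x) + b * (k x * resolventIm x)) π :=
      ((i2 _).const_mul a).add ((i2 _).const_mul b)
    rw [integral_add i1 i3, integral_add ((i2 _).const_mul a) ((i2 _).const_mul b),
      integral_const_mul, integral_const_mul, hk.2, (hbase k hk).1, (hbase k hk).2]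
    simp
  have hRe : ∀ k ∈ N, (fun x => k x * resolventRe x) ∈ N := by
    rintro k hk
    refine ⟨memLp_mul_bounded hk.1 _, fun p => ?_⟩
    rw [← (hIm k hk).2 (X * p)]
    refine integral_congr_ae (.of_forall fun x => ?_)
    change k x * (x / (1 + x ^ 2)) * _ = k x * (1 / (1 + x ^ 2)) * _
    simp only [eval_mul, eval_X]
    ring
  let A : StarSubalgebra ℝ (ℝ →ᵇ ℝ) := StarAlgebra.adjoin ℝ {resolventRe, resolventIm}
  have hA : ∀ F ∈ A, ∀ k ∈ N, (fun x => k x * F x) ∈ N := by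
    intro F hF
    induction hF using StarAlgebra.adjoin_induction with
    | mem F hF =>
      rcases hF with rfl | rfl
      · exact hRe
      · exact hIm
    | algebraMap r =>
      rintro k ⟨hk, hk0⟩
      refine ⟨memLp_mul_bounded hk _, fun p => ?_⟩
      rw [← mul_zero r, ← hk0 p, ← integral_const_mul]
      refine integral_congr_ae (.of_forall fun x => ?_)
      simp only [BoundedContinuousFunction.algebraMap_apply, smul_eq_mul, mul_one]
      ring
    | add F G _ _ hF hG =>
      intro k hk
      refine ⟨memLp_mul_bounded hk.1 _, fun p => ?_⟩
      have i : ∀ F : ℝ →ᵇ ℝ, Integrable (fun x => k x * F x * p.eval x) π := fun F =>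
        (memLp_mul_bounded hk.1 F).integrable_mul (memLp_two_eval hmom p)
      simp only [BoundedContinuousFunction.coe_add, Pi.add_apply, mul_add, add_mul]
      rw [integral_add (i F) (i G), (hF k hk).2 p, (hG k hk).2 p, add_zero]
    | mul F G _ _ hF hG =>
      intro k hk
      have := hG _ (hF k hk)
      simpa only [BoundedContinuousFunction.coe_mul, Pi.mul_apply, mul_assoc] using this
    | star F _ hF => simpa using hF
  have hint : Integrable h π := hh.integrable one_le_two
  have hA0 : ∀ F ∈ A, ∫ x, h x * F x ∂π = 0 := fun F hF => by
    simpa using (hA F hF h ⟨hh, horth⟩).2 1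
  have hsep : (A.map (BoundedContinuousFunction.toContinuousMapStarₐ ℝ)).SeparatesPoints := by
    intro x y hxy
    by_contra! hcon
    have hF : ∀ F ∈ A, F x = F y := fun F hF =>
      hcon F ⟨F.toContinuousMap, ⟨F, hF, rfl⟩, rfl⟩
    have h1 : x / (1 + x ^ 2) = y / (1 + y ^ 2) :=
      hF _ (StarAlgebra.subset_adjoin ℝ _ (Set.mem_insert _ _))
    have h2 : 1 / (1 + x ^ 2) = 1 / (1 + y ^ 2) :=
      hF _ (StarAlgebra.subset_adjoin ℝ _ (Set.mem_insert_of_mem _ rfl))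
    apply hxy
    rw [div_eq_mul_one_div, h2, div_eq_mul_one_div y] at h1
    exact mul_right_cancel₀ (by positivity) h1
  -- The positive and negative parts of `h π` agree on the algebra.
  have hfin : ∀ k : ℝ → ℝ, Integrable k π →
      IsFiniteMeasure (π.withDensity fun x => ENNReal.ofReal (k x)) := fun k hk =>
    isFiniteMeasure_withDensity_ofReal hk.2
  have := hfin h hint
  have := hfin (-h) hint.neg
  have hdens : ∀ k : ℝ → ℝ, Integrable k π → ∀ F : ℝ →ᵇ ℝ,
      ∫ x, F x ∂(π.withDensity fun x => ENNReal.ofReal (k x)) =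
        ∫ x, max (k x) 0 * F x ∂π := by
    intro k hk F
    rw [integral_withDensity_eq_integral_toReal_smul₀ hk.aemeasurable.ennreal_ofReal
      (.of_forall fun x => ENNReal.ofReal_lt_top)]
    simp_rw [ENNReal.toReal_ofReal', smul_eq_mul]
  have heq := ext_of_forall_mem_subalgebra_integral_eq_of_polish (𝕜 := ℝ)
    (P := π.withDensity fun x => ENNReal.ofReal (h x))
    (P' := π.withDensity fun x => ENNReal.ofReal ((-h) x)) hsep fun F hF => by
      rw [hdens h hint, hdens _ hint.neg, ← sub_eq_zero]
      have i1 : ∀ k : ℝ → ℝ, MemLp k 2 π → Integrable (fun x => max (k x) 0 * F x) π :=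
        fun k hk => (memLp_mul_bounded hk.pos_part F).integrable one_le_two
      rw [← integral_sub (i1 _ hh) (i1 _ hh.neg)]
      refine Eq.trans ?_ (hA0 F hF)
      refine integral_congr_ae (.of_forall fun x => ?_)
      simp only [Pi.neg_apply]
      rw [← sub_mul, max_zero_sub_eq_self]
  rw [withDensity_eq_iff hint.aemeasurable.ennreal_ofReal
    hint.neg.aemeasurable.ennreal_ofReal (by
      have := (hfin h hint).measure_univ_lt_top
      rw [withDensity_apply _ MeasurableSet.univ, Measure.restrict_univ] at this
      exact this.ne)] at heq
  filter_upwards [heq] with x hx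
  simp only [Pi.neg_apply] at hx
  rcases le_total (h x) 0 with h0 | h0
  · rw [ENNReal.ofReal_of_nonpos h0, eq_comm, ENNReal.ofReal_eq_zero] at hx
    exact le_antisymm h0 (neg_nonpos.mp hx)
  · rw [ENNReal.ofReal_of_nonpos (neg_nonpos.mpr h0), ENNReal.ofReal_eq_zero] at hx
    exact le_antisymm hx h0

/-- The polynomials are dense in `L²` of a moment determinate measure. -/
theorem exists_polynomial_approx {π : Measure ℝ} [IsProbabilityMeasure π]
    (hmom : HasFiniteMoments π) (hdet : MomentDeterminate π) {g : ℝ → ℝ} (hg : MemLp g 2 π)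
    {ε : ℝ} (hε : 0 < ε) : ∃ p : ℝ[X], ∫ x, (g x - p.eval x) ^ 2 ∂π ≤ ε := by
  let ev : ℝ[X] →ₗ[ℝ] Lp ℝ 2 π :=
    { toFun := fun p => (memLp_two_eval hmom p).toLp _
      map_add' := fun p q => by
        rw [← MemLp.toLp_add]
        congr 1
        ext x
        simp
      map_smul' := fun a p => by
        rw [RingHom.id_apply, ← MemLp.toLp_const_smul]
        congr 1
        ext x
        simp }
  have hev : ∀ p, ev p =ᵐ[π] fun x => p.eval x := fun p => (memLp_two_eval hmom p).coeFn_toLp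
  have htop : (LinearMap.range ev).topologicalClosure = ⊤ := by
    rw [Submodule.topologicalClosure_eq_top_iff, Submodule.eq_bot_iff]
    intro h hh
    rw [Lp.eq_zero_iff_ae_eq_zero]
    refine ae_eq_zero_of_orthogonal_polynomials hmom hdet (Lp.memLp h) fun p => ?_
    have h0 := (Submodule.mem_orthogonal' _ _).mp hh (ev p) ⟨p, rfl⟩
    rw [L2.inner_def] at h0
    rw [← h0]
    refine integral_congr_ae ?_
    filter_upwards [hev p] with x hx
    rw [hx, real_inner_comm]
    rfl
  have hmem : hg.toLp g ∈ closure (LinearMap.range ev : Set (Lp ℝ 2 π)) := by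
    rw [← Submodule.topologicalClosure_coe, htop]
    trivial
  obtain ⟨_, ⟨p, rfl⟩, hp⟩ := Metric.mem_closure_iff.mp hmem (√ε) (Real.sqrt_pos.mpr hε)
  refine ⟨p, ?_⟩
  rw [dist_eq_norm] at hp
  have h1 : ‖hg.toLp g - ev p‖ ^ 2 = ∫ x, (g x - p.eval x) ^ 2 ∂π := by
    rw [← real_inner_self_eq_norm_sq, L2.inner_def]
    refine integral_congr_ae ?_
    filter_upwards [hev p, hg.coeFn_toLp, Lp.coeFn_sub (hg.toLp g) (ev p)] with x h1 h2 h3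
    rw [h3, Pi.sub_apply, h1, h2, real_inner_self_eq_norm_sq, Real.norm_eq_abs, sq_abs]
  rw [← h1, ← Real.sq_sqrt hε.le]
  gcongr

/-! ### Orthonormal polynomials -/

/-- A measure whose distribution function has infinitely many points of increase is not carried by
the zero set of a nonzero polynomial. -/
theorem integral_eval_sq_pos {π : Measure ℝ} [IsProbabilityMeasure π]
    (hmom : HasFiniteMoments π) (hinc : (pointsOfIncrease (ProbabilityTheory.cdf π)).Infinite)
    {p : ℝ[X]} (hp : p ≠ 0) : 0 < ∫ x, p.eval x * p.eval x ∂π := by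
  have hnn : 0 ≤ ∫ x, p.eval x * p.eval x ∂π := integral_nonneg fun x => mul_self_nonneg _
  refine hnn.lt_of_ne fun h0 => hinc ?_
  have hi : Integrable (fun x => p.eval x * p.eval x) π :=
    (memLp_two_eval hmom p).integrable_mul (memLp_two_eval hmom p)
  have hae := (integral_eq_zero_iff_of_nonneg (fun x => mul_self_nonneg _) hi).mp h0.symm
  have hnull : π {x | p.eval x ≠ 0} = 0 := by
    rw [← nonpos_iff_eq_zero, ← ae_iff.mp hae]
    refine measure_mono fun x hx => ?_
    simpa using hx
  refine (p.roots.toFinset.finite_toSet).subset fun x hx => ?_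
  by_contra hroot
  have hpx : p.eval x ≠ 0 := by simpa [hp] using hroot
  have hopen : IsOpen {x | p.eval x ≠ 0} := isOpen_ne_fun p.continuous continuous_const
  obtain ⟨ε, hε, hball⟩ := Metric.isOpen_iff.mp hopen x hpx
  have hlt := hx (ε / 2) (by positivity)
  rw [ProbabilityTheory.cdf_eq_real, ProbabilityTheory.cdf_eq_real] at hlt
  have hsub : Set.Ioc (x - ε / 2) (x + ε / 2) ⊆ {x | p.eval x ≠ 0} := by
    intro y hy
    refine hball ?_
    rw [Metric.mem_ball, Real.dist_eq, abs_lt]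
    constructor <;> linarith [hy.1, hy.2]
  have hz : π.real (Set.Ioc (x - ε / 2) (x + ε / 2)) = 0 := by
    rw [measureReal_def, measure_mono_null hsub hnull, ENNReal.toReal_zero]
  have hle := measureReal_union_le (μ := π) (Set.Iic (x - ε / 2))
    (Set.Ioc (x - ε / 2) (x + ε / 2))
  rw [Set.Iic_union_Ioc_eq_Iic (by linarith), hz] at hle
  linarith

/-- The inner product `(p, q) ↦ ∫ p q dπ` on polynomials, as a bilinear form. -/
noncomputable def momentForm {π : Measure ℝ} (hmom : HasFiniteMoments π) :
    ℝ[X] →ₗ[ℝ] ℝ[X] →ₗ[ℝ] ℝ :=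
  LinearMap.mk₂ ℝ (fun p q => ∫ x, p.eval x * q.eval x ∂π)
    (fun p p' q => by
      simp only [eval_add, add_mul]
      exact integral_add ((memLp_two_eval hmom p).integrable_mul (memLp_two_eval hmom q))
        ((memLp_two_eval hmom p').integrable_mul (memLp_two_eval hmom q)))
    (fun c p q => by
      simp only [eval_smul, smul_eq_mul, mul_assoc]
      exact integral_const_mul _ _)
    (fun p q q' => by
      simp only [eval_add, mul_add]
      exact integral_add ((memLp_two_eval hmom p).integrable_mul (memLp_two_eval hmom q))
        ((memLp_two_eval hmom p).integrable_mul (memLp_two_eval hmom q')))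
    (fun c p q => by
      simp only [eval_smul, smul_eq_mul, mul_left_comm _ c]
      exact integral_const_mul _ _)

theorem momentForm_apply {π : Measure ℝ} (hmom : HasFiniteMoments π) (p q : ℝ[X]) :
    momentForm hmom p q = ∫ x, p.eval x * q.eval x ∂π := rfl

theorem momentForm_comm {π : Measure ℝ} (hmom : HasFiniteMoments π) (p q : ℝ[X]) :
    momentForm hmom p q = momentForm hmom q p := by
  simp only [momentForm_apply, mul_comm]

/-- `p n` is orthogonal to all polynomials of lower degree, as `p 0, …, p (n - 1)` span these. -/
theorem IsOrthonormalPolynomials.momentForm_eq_zero {π : Measure ℝ} {p : ℕ → ℝ[X]}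
    (hp : IsOrthonormalPolynomials π p) (hmom : HasFiniteMoments π) {n : ℕ} {r : ℝ[X]}
    (hr : r.degree < n) : momentForm hmom (p n) r = 0 := by
  let S : Polynomial.Sequence ℝ := ⟨p, hp.degree_eq⟩
  have hspan : degreeLT ℝ n ≤ LinearMap.ker (momentForm hmom (p n)) := by
    rw [← S.span_degreeLT fun i _ => (hp.leadingCoeff_pos i).ne'.isUnit, Submodule.span_le]
    rintro _ ⟨m, hm, rfl⟩
    change ∫ x, (p n).eval x * (p m).eval x ∂π = 0
    rw [hp.orthonormal, if_neg (Set.mem_Iio.mp hm).ne']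
  exact hspan (mem_degreeLT.mpr hr)

/-- Existence and uniqueness of the orthonormal polynomials. -/
theorem existsUnique_isOrthonormalPolynomials {π : Measure ℝ} [IsProbabilityMeasure π]
    (hmom : HasFiniteMoments π) (hinc : (pointsOfIncrease (ProbabilityTheory.cdf π)).Infinite) :
    ∃! p : ℕ → ℝ[X], IsOrthonormalPolynomials π p := by
  have hpos : ∀ p : ℝ[X], p ≠ 0 → 0 < momentForm hmom p p := fun p hp =>
    integral_eval_sq_pos hmom hinc hp
  have hex : ∀ n : ℕ, ∃ q : ℝ[X], q.Monic ∧ q.degree = n ∧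
      ∀ s : ℝ[X], s.degree < n → momentForm hmom q s = 0 := by
    intro n
    have : FiniteDimensional ℝ (degreeLT ℝ n) :=
      Module.Finite.equiv (degreeLTEquiv ℝ n).symm
    let T : degreeLT ℝ n →ₗ[ℝ] Module.Dual ℝ (degreeLT ℝ n) :=
      (momentForm hmom).domRestrict₁₂ (degreeLT ℝ n) (degreeLT ℝ n)
    have hinj : Function.Injective T := by
      rw [injective_iff_map_eq_zero]
      intro r hr
      by_contra hr0
      have h := hpos r (by simpa using hr0)
      have h' : momentForm hmom r r = 0 := LinearMap.congr_fun hr r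
      exact h.ne' h'
    obtain ⟨r, hr⟩ := (LinearMap.injective_iff_surjective_of_finrank_eq_finrank
      (Subspace.dual_finrank_eq).symm).mp hinj ((momentForm hmom (X ^ n)).domRestrict _)
    have hrd : (r : ℝ[X]).degree < n := mem_degreeLT.mp r.2
    refine ⟨X ^ n - (r : ℝ[X]), monic_X_pow_sub hrd, ?_, fun s hs => ?_⟩
    · rw [degree_sub_eq_left_of_degree_lt (by rwa [degree_X_pow]), degree_X_pow]
    · have h : momentForm hmom r s = momentForm hmom (X ^ n) s :=
        LinearMap.congr_fun hr ⟨s, mem_degreeLT.mpr hs⟩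
      rw [map_sub, LinearMap.sub_apply, h, sub_self]
  choose q hqm hqd hqo using hex
  have hc : ∀ n, 0 < (√(momentForm hmom (q n) (q n)))⁻¹ := fun n =>
    inv_pos.mpr (Real.sqrt_pos.mpr (hpos _ (hqm n).ne_zero))
  refine ⟨fun n => C (√(momentForm hmom (q n) (q n)))⁻¹ * q n, ⟨fun n => ?_, fun n => ?_,
    fun n m => ?_⟩, fun p hp => ?_⟩
  · rw [degree_C_mul (hc n).ne', hqd]
  · rw [leadingCoeff_mul, leadingCoeff_C, (hqm n).leadingCoeff, mul_one]
    exact hc n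
  · rw [← momentForm_apply hmom, ← smul_eq_C_mul, ← smul_eq_C_mul, map_smul,
      LinearMap.map_smul₂, smul_smul, smul_eq_mul]
    split_ifs with hnm
    · subst hnm
      have h := Real.mul_self_sqrt (hpos _ (hqm n).ne_zero).le
      rw [← mul_inv, h, inv_mul_cancel₀ (hpos _ (hqm n).ne_zero).ne']
    · rcases lt_or_gt_of_ne hnm with h | h
      · rw [momentForm_comm hmom (q n) (q m), hqo m (q n) (by rw [hqd]; exact_mod_cast h), mul_zero]
      · rw [hqo n (q m) (by rw [hqd]; exact_mod_cast h), mul_zero]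
  · funext n
    -- `p n` is a multiple of `q n`, as the difference is orthogonal to itself.
    have hl := hp.leadingCoeff_pos n
    have heq : p n = C (p n).leadingCoeff * q n := by
      rw [← sub_eq_zero]
      by_contra h0
      have hd : (p n - C (p n).leadingCoeff * q n).degree < n := by
        rw [← hp.degree_eq n]
        refine degree_sub_lt_left ?_ (leadingCoeff_ne_zero.mp hl.ne') ?_
        · rw [degree_C_mul hl.ne', hqd, hp.degree_eq]
        · rw [leadingCoeff_mul, leadingCoeff_C, (hqm n).leadingCoeff, mul_one]
      refine (hpos _ h0).ne' ?_
      rw [LinearMap.map_sub₂, hp.momentForm_eq_zero hmom hd, ← smul_eq_C_mul,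
        LinearMap.map_smul₂, smul_eq_C_mul, hqo n _ hd, smul_zero, sub_zero]
    have hn : momentForm hmom (p n) (p n) = 1 := by
      rw [momentForm_apply, hp.orthonormal, if_pos rfl]
    rw [heq, ← smul_eq_C_mul, map_smul, LinearMap.map_smul₂, smul_eq_mul, smul_eq_mul,
      ← mul_assoc, ← sq] at hn
    have h2 : (p n).leadingCoeff = (√(momentForm hmom (q n) (q n)))⁻¹ := by
      rw [← mul_eq_one_iff_eq_inv₀ (Real.sqrt_pos.mpr (hpos _ (hqm n).ne_zero)).ne',
        ← sq_eq_sq₀ (by positivity) zero_le_one, mul_pow,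
        Real.sq_sqrt (hpos _ (hqm n).ne_zero).le, hn, one_pow]
    rw [← h2]
    exact heq

theorem IsOrthonormalPolynomials.zero_eq_one {π : Measure ℝ} [IsProbabilityMeasure π]
    {p : ℕ → ℝ[X]} (hp : IsOrthonormalPolynomials π p) : p 0 = 1 := by
  have h := eq_C_of_degree_eq_zero (hp.degree_eq 0)
  have hl := hp.leadingCoeff_pos 0
  have ho := hp.orthonormal 0 0
  rw [h] at hl ho
  simp only [eval_C, integral_const, probReal_univ, one_smul, if_true] at ho
  rw [leadingCoeff_C] at hl
  rw [h, show (p 0).coeff 0 = 1 by nlinarith, C_1]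

theorem IsOrthonormalPolynomials.span_eq_top {π : Measure ℝ} {p : ℕ → ℝ[X]}
    (hp : IsOrthonormalPolynomials π p) : Submodule.span ℝ (Set.range p) = ⊤ :=
  Polynomial.Sequence.span (S := ⟨p, hp.degree_eq⟩) fun n => (hp.leadingCoeff_pos n).ne'.isUnit

/-! ### Products of functions of independent coordinates -/

section Product

variable {ι Ω : Type*} [MeasurableSpace Ω] {ρ : Measure Ω} {c : ι → Ω → ℝ} {ρc : ι → Measure ℝ}

theorem integral_prod_coord (hc : ∀ j, Measurable (c j)) (hindep : ProbabilityTheory.iIndepFun c ρ)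
    (hlaw : ∀ j, ρ.map (c j) = ρc j) (T : Finset ι) {u : ι → ℝ → ℝ}
    (hu : ∀ j ∈ T, AEStronglyMeasurable (u j) (ρc j)) :
    ∫ ω, ∏ j ∈ T, u j (c j ω) ∂ρ = ∏ j ∈ T, ∫ x, u j x ∂ρc j := by
  have h := (hindep.precomp (g := fun j : T => (j : ι))
    Subtype.val_injective).integral_fun_prod_comp (f := fun j : T => u j)
    (fun j => (hc j).aemeasurable) fun j => by rw [hlaw]; exact hu j j.2
  simp_rw [← Finset.prod_coe_sort T]
  rw [h]
  refine Finset.prod_congr rfl fun j _ => ?_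
  rw [← hlaw, integral_map (hc j).aemeasurable (by rw [hlaw]; exact hu j j.2)]

variable [∀ j, IsProbabilityMeasure (ρc j)]

theorem integrable_prod_coord (hc : ∀ j, Measurable (c j))
    (hindep : ProbabilityTheory.iIndepFun c ρ)
    (hlaw : ∀ j, ρ.map (c j) = ρc j) (T : Finset ι) {u : ι → ℝ → ℝ}
    (hu : ∀ j ∈ T, Integrable (u j) (ρc j)) :
    Integrable (fun ω => ∏ j ∈ T, u j (c j ω)) ρ := by
  have h := ProbabilityTheory.iIndepFun.map_fun_eq_pi_map (f := fun j : T => c j)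
    (fun j => (hc j).aemeasurable) (hindep.precomp Subtype.val_injective)
  simp_rw [hlaw] at h
  have hi : Integrable (fun x : T → ℝ => ∏ j : T, u j (x j)) (Measure.pi fun j : T => ρc j) :=
    Integrable.fintype_prod_dep (f := fun j : T => u j) fun j => hu j j.2
  rw [← h] at hi
  simp_rw [← Finset.prod_coe_sort T]
  exact hi.comp_measurable (measurable_pi_lambda _ fun j => hc j)

theorem memLp_two_prod_coord (hc : ∀ j, Measurable (c j))
    (hindep : ProbabilityTheory.iIndepFun c ρ)
    (hlaw : ∀ j, ρ.map (c j) = ρc j) (T : Finset ι) {u : ι → ℝ → ℝ}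
    (hu : ∀ j ∈ T, MemLp (u j) 2 (ρc j)) :
    MemLp (fun ω => ∏ j ∈ T, u j (c j ω)) 2 ρ := by
  have hm : AEStronglyMeasurable (fun ω => ∏ j ∈ T, u j (c j ω)) ρ :=
    (integrable_prod_coord hc hindep hlaw T fun j hj =>
      (hu j hj).integrable one_le_two).aestronglyMeasurable
  rw [memLp_two_iff_integrable_sq hm]
  simp_rw [← Finset.prod_pow]
  exact integrable_prod_coord hc hindep hlaw T (u := fun j x => u j x ^ 2)
    fun j hj => (hu j hj).integrable_sq

/-- If `h` is orthogonal to all finite products of orthonormal polynomials in independent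
coordinates, then it is orthogonal to all finite products of square integrable functions of the
coordinates: the factors are replaced one at a time, using that polynomials are dense in `L²` of
the law of that coordinate. -/
theorem integral_mul_prod_coord_eq_zero (hc : ∀ j, Measurable (c j))
    (hindep : ProbabilityTheory.iIndepFun c ρ) (hlaw : ∀ j, ρ.map (c j) = ρc j)
    (hmom : ∀ j, HasFiniteMoments (ρc j)) (hdet : ∀ j, MomentDeterminate (ρc j))
    {p : ι → ℕ → ℝ[X]} (hp : ∀ j, IsOrthonormalPolynomials (ρc j) (p j))
    {h : Ω → ℝ} (hh : MemLp h 2 ρ)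
    (horth : ∀ a : ι →₀ ℕ, ∫ ω, h ω * a.prod (fun j n => (p j n).eval (c j ω)) ∂ρ = 0)
    (T : Finset ι) {u : ι → ℝ → ℝ} (hu : ∀ j ∈ T, MemLp (u j) 2 (ρc j)) :
    ∫ ω, h ω * ∏ j ∈ T, u j (c j ω) ∂ρ = 0 := by
  classical
  -- Induction on the set `S` of indices whose factor need not be an orthonormal polynomial.
  suffices key : ∀ S : Finset ι, ∀ u : ι → ℝ → ℝ, (∀ j ∈ T, MemLp (u j) 2 (ρc j)) →
      (∀ j ∈ T, j ∉ S → ∃ n, u j = fun x => (p j n).eval x) →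
      ∫ ω, h ω * ∏ j ∈ T, u j (c j ω) ∂ρ = 0 from
    key T u hu fun j hj hj' => absurd hj hj'
  intro S
  induction S using Finset.induction_on with
  | empty =>
    intro u _ hu
    have hu' : ∀ j, ∃ n, j ∈ T → u j = fun x => (p j n).eval x := by
      intro j
      by_cases hj : j ∈ T
      · obtain ⟨n, hn⟩ := hu j hj (Finset.notMem_empty j)
        exact ⟨n, fun _ => hn⟩
      · exact ⟨0, fun h => absurd h hj⟩
    choose n hn using hu'
    rw [← horth (Finsupp.onFinset T (fun j => if j ∈ T then n j else 0) (by simp +contextual))]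
    congr 1
    ext ω
    rw [Finsupp.prod_of_support_subset _ Finsupp.support_onFinset_subset _
      fun j _ => by simp [(hp j).zero_eq_one]]
    congr 1
    refine Finset.prod_congr rfl fun j hj => ?_
    rw [hn j hj]
    simp [hj]
  | insert i S _ ih =>
    intro u hu hup
    by_cases hiT : i ∈ T
    swap
    · refine ih u hu fun j hj hjS => hup j hj ?_
      rw [Finset.mem_insert, not_or]
      exact ⟨fun h => hiT (h ▸ hj), hjS⟩
    let G : Ω → ℝ := fun ω => ∏ j ∈ T.erase i, u j (c j ω)
    have hform : ∀ g : ℝ → ℝ, (fun ω => ∏ j ∈ T, Function.update u i g j (c j ω)) =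
        fun ω => g (c i ω) * G ω := by
      intro g
      ext ω
      rw [← Finset.mul_prod_erase T _ hiT, Function.update_self]
      congr 1
      refine Finset.prod_congr rfl fun j hj => ?_
      rw [Function.update_of_ne (Finset.ne_of_mem_erase hj)]
    have hupd : ∀ g : ℝ → ℝ, MemLp g 2 (ρc i) →
        ∀ j ∈ T, MemLp (Function.update u i g j) 2 (ρc j) := by
      intro g hg j hj
      by_cases hji : j = i
      · subst hji
        rwa [Function.update_self]
      · rw [Function.update_of_ne hji]
        exact hu j hj
    have hmem : ∀ g : ℝ → ℝ, MemLp g 2 (ρc i) → MemLp (fun ω => g (c i ω) * G ω) 2 ρ := by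
      intro g hg
      rw [← hform]
      exact memLp_two_prod_coord hc hindep hlaw T (hupd g hg)
    have hsq : ∀ g : ℝ → ℝ, MemLp g 2 (ρc i) → ∫ ω, (g (c i ω) * G ω) ^ 2 ∂ρ =
        (∫ x, g x ^ 2 ∂ρc i) * ∏ j ∈ T.erase i, ∫ x, u j x ^ 2 ∂ρc j := by
      intro g hg
      have h1 : (fun ω => (g (c i ω) * G ω) ^ 2) =
          fun ω => ∏ j ∈ T, (Function.update u i g j (c j ω)) ^ 2 := by
        ext ω
        rw [Finset.prod_pow]
        exact congrArg (· ^ 2) (congrFun (hform g) ω).symm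
      rw [h1, integral_prod_coord hc hindep hlaw T
        (u := fun j x => Function.update u i g j x ^ 2)
        fun j hj => ((hupd g hg j hj).aestronglyMeasurable.pow 2),
        ← Finset.mul_prod_erase T _ hiT, Function.update_self]
      congr 1
      refine Finset.prod_congr rfl fun j hj => ?_
      rw [Function.update_of_ne (Finset.ne_of_mem_erase hj)]
    have hpoly : ∀ q : ℝ[X], ∫ ω, h ω * (q.eval (c i ω) * G ω) ∂ρ = 0 := by
      intro q
      have hq : q ∈ Submodule.span ℝ (Set.range (p i)) := by rw [(hp i).span_eq_top]; trivial
      have hi : ∀ q : ℝ[X], Integrable (fun ω => h ω * (q.eval (c i ω) * G ω)) ρ := fun q =>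
        hh.integrable_mul (hmem _ (memLp_two_eval (hmom i) q))
      induction hq using Submodule.span_induction with
      | mem q hq =>
        obtain ⟨n, rfl⟩ := hq
        have hmp := memLp_two_eval (hmom i) (p i n)
        rw [← ih (Function.update u i fun x => (p i n).eval x) (hupd _ hmp) fun j hj hjS => ?_]
        · congr 1
          ext ω
          rw [congrFun (hform fun x => (p i n).eval x) ω]
        · by_cases hji : j = i
          · subst hji
            exact ⟨n, Function.update_self _ _ _⟩
          · rw [Function.update_of_ne hji]
            exact hup j hj (by simp [hji, hjS])
      | zero => simp
      | add q r _ _ hq hr =>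
        simp_rw [eval_add, add_mul, mul_add]
        rw [integral_add (hi q) (hi r), hq, hr, add_zero]
      | smul a q _ hq =>
        simp_rw [eval_smul, smul_eq_mul, mul_assoc, mul_left_comm _ a]
        rw [integral_const_mul, hq, mul_zero]
    have hG : (fun ω => ∏ j ∈ T, u j (c j ω)) = fun ω => u i (c i ω) * G ω := by
      rw [← hform, Function.update_eq_self]
    have hfin := integral_mul_eq_zero_of_approx hh (hmem (u i) (hu i hiT)) fun ε hε => by
      set M := ∏ j ∈ T.erase i, ∫ x, u j x ^ 2 ∂ρc j
      have hM : 0 ≤ M := Finset.prod_nonneg fun j _ => integral_nonneg fun x => sq_nonneg _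
      obtain ⟨q, hq⟩ := exists_polynomial_approx (hmom i) (hdet i) (hu i hiT)
        (show 0 < ε / (M + 1) by positivity)
      have hmq := memLp_two_eval (hmom i) q
      refine ⟨_, hmem _ hmq, hpoly q, ?_⟩
      have h1 := hsq _ ((hu i hiT).sub hmq)
      simp only [Pi.sub_apply, sub_mul] at h1
      rw [h1]
      calc _ ≤ ε / (M + 1) * M := mul_le_mul_of_nonneg_right hq hM
        _ ≤ ε := by
          rw [div_mul_eq_mul_div, div_le_iff₀ (by positivity)]
          nlinarith
    rw [← hfin]
    congr 1
    ext ω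
    rw [congrFun hG ω]

end Product

/-- A square integrable function on a space whose σ-algebra is generated by the coordinates `c j`
vanishes almost everywhere if it is orthogonal to all finite products of square integrable
functions of the coordinates: such products include the indicators of cylinder sets, which form a
generating π-system. -/
theorem ae_eq_zero_of_orthogonal_prod_coord {ι Ω : Type*} [mΩ : MeasurableSpace Ω]
    {ρ : Measure Ω} [IsProbabilityMeasure ρ] {c : ι → Ω → ℝ} {ρc : ι → Measure ℝ}
    [∀ j, IsProbabilityMeasure (ρc j)]
    (hgen : mΩ = ⨆ j, MeasurableSpace.comap (c j) inferInstance)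
    {h : Ω → ℝ} (hh : MemLp h 2 ρ)
    (horth : ∀ (T : Finset ι) (u : ι → ℝ → ℝ), (∀ j ∈ T, MemLp (u j) 2 (ρc j)) →
      ∫ ω, h ω * ∏ j ∈ T, u j (c j ω) ∂ρ = 0) : h =ᵐ[ρ] 0 := by
  classical
  have hint : Integrable h ρ := hh.integrable one_le_two
  have h0 : ∫ ω, h ω ∂ρ = 0 := by simpa using horth ∅ (fun _ _ => 0) (by simp)
  have hmle : ∀ j, MeasurableSpace.comap (c j) inferInstance ≤ mΩ := fun j => by
    rw [hgen]
    exact le_iSup (fun j => MeasurableSpace.comap (c j) inferInstance) j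
  let π : ι → Set (Set Ω) := fun j =>
    {s | MeasurableSet[MeasurableSpace.comap (c j) inferInstance] s}
  have hgenπ : mΩ = MeasurableSpace.generateFrom (piiUnionInter π Set.univ) := by
    rw [generateFrom_piiUnionInter_measurableSet
      (fun j => MeasurableSpace.comap (c j) inferInstance)]
    simpa using hgen
  have hpi : IsPiSystem (piiUnionInter π Set.univ) :=
    isPiSystem_piiUnionInter π (fun j => @MeasurableSpace.isPiSystem_measurableSet Ω
      (MeasurableSpace.comap (c j) inferInstance)) _
  refine hint.ae_eq_zero_of_forall_setIntegral_eq_zero fun s hs _ => ?_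
  induction s, hs using MeasurableSpace.induction_on_inter hgenπ hpi with
  | empty => simp
  | basic s hs =>
    obtain ⟨t, -, f, hf, rfl⟩ := hs
    have hB : ∀ j, ∃ B : Set ℝ, j ∈ t → MeasurableSet B ∧ c j ⁻¹' B = f j := by
      intro j
      by_cases hj : j ∈ t
      · obtain ⟨B, hB, hB'⟩ := hf j hj
        exact ⟨B, fun _ => ⟨hB, hB'⟩⟩
      · exact ⟨∅, fun h => absurd h hj⟩
    choose B hB using hB
    have hms : MeasurableSet (⋂ j ∈ t, f j) :=
      Finset.measurableSet_biInter _ fun j hj => hmle j _ (hf j hj)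
    rw [← integral_indicator hms, ← horth t (fun j => (B j).indicator 1) fun j hj =>
      (memLp_const (1 : ℝ)).indicator (hB j hj).1]
    congr 1
    ext ω
    by_cases hω : ω ∈ ⋂ j ∈ t, f j
    · rw [Set.indicator_of_mem hω, Finset.prod_eq_one, mul_one]
      intro j hj
      have : c j ω ∈ B j := by
        have := Set.mem_iInter₂.mp hω j hj
        rwa [← (hB j hj).2] at this
      simp [this]
    · rw [Set.indicator_of_notMem hω]
      simp only [Set.mem_iInter, not_forall] at hω
      obtain ⟨j, hj, hωj⟩ := hω
      have : c j ω ∉ B j := by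
        rw [← (hB j hj).2] at hωj
        exact hωj
      rw [Finset.prod_eq_zero hj (by simp [this]), mul_zero]
  | compl s hs ih =>
    have := integral_add_compl hs hint
    rw [ih (measure_lt_top _ _), h0, zero_add] at this
    exact this
  | iUnion s hd hs ih =>
    rw [integral_iUnion hs hd hint.integrableOn]
    simp [ih _ (measure_lt_top _ _)]

/-- The Borel σ-algebra of a Hilbert space with a countable Hilbert basis is generated by the
coordinates, since every vector is the limit of its partial expansions. -/
theorem borel_eq_iSup_comap_coord {ι X : Type*} [Countable ι] [NormedAddCommGroup X]
    [InnerProductSpace ℝ X] [TopologicalSpace.SeparableSpace X]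
    [mX : MeasurableSpace X] [BorelSpace X] (ξ : HilbertBasis ι ℝ X) :
    mX = ⨆ j, MeasurableSpace.comap (fun f : X => (inner ℝ (ξ j) f : ℝ)) inferInstance := by
  refine le_antisymm ?_ (iSup_le fun j => ?_)
  · let m : MeasurableSpace X :=
      ⨆ j, MeasurableSpace.comap (fun f : X => (inner ℝ (ξ j) f : ℝ)) inferInstance
    have hcoord : ∀ j, Measurable[m] fun f : X => (inner ℝ (ξ j) f : ℝ) := fun j =>
      Measurable.mono (comap_measurable _)
        (le_iSup (fun j => MeasurableSpace.comap
          (fun f : X => (inner ℝ (ξ j) f : ℝ)) inferInstance) j) le_rfl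
    have hpart : ∀ s : Finset ι,
        StronglyMeasurable[m] fun f : X => ∑ j ∈ s, (inner ℝ (ξ j) f : ℝ) • ξ j := fun s =>
      Finset.stronglyMeasurable_fun_sum s fun j _ =>
        ((hcoord j).stronglyMeasurable).smul_const _
    have hid : StronglyMeasurable[m] fun f : X => f := by
      refine stronglyMeasurable_of_tendsto atTop hpart ?_
      rw [tendsto_pi_nhds]
      intro f
      have h := ξ.hasSum_repr f
      simp only [HilbertBasis.repr_apply_apply] at h
      exact h
    intro s hs
    exact @StronglyMeasurable.measurable X X _ m _ _ mX _ hid s hs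
  · exact Measurable.comap_le (by fun_prop)

/-! ### The tensor product basis of `L²` -/

section Basis

variable {ι κ X Y : Type*}
  [NormedAddCommGroup X] [InnerProductSpace ℝ X] [MeasurableSpace X] [BorelSpace X]
  [NormedAddCommGroup Y] [InnerProductSpace ℝ Y]
  {ξ : HilbertBasis ι ℝ X} {ψ : HilbertBasis κ ℝ Y}
  {ρ : Measure X} {ρc : ι → Measure ℝ} {p : ι → ℕ → ℝ[X]}

theorem measurable_coord (ξ : HilbertBasis ι ℝ X) (j : ι) :
    Measurable fun f : X => (inner ℝ (ξ j) f : ℝ) :=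
  (continuous_const.inner continuous_id).measurable

variable [∀ j, IsProbabilityMeasure (ρc j)]

/-- The scalar factor of `polyOp` as a product over any finite set containing the support. -/
theorem finsuppProd_eval_eq_prod (hp : ∀ j, IsOrthonormalPolynomials (ρc j) (p j)) {a : ι →₀ ℕ}
    {T : Finset ι} (hT : a.support ⊆ T) (c : ι → ℝ) :
    a.prod (fun j n => (p j n).eval (c j)) = ∏ j ∈ T, (p j (a j)).eval (c j) :=
  Finsupp.prod_of_support_subset _ hT _ fun j _ => by simp [(hp j).zero_eq_one]

theorem memLp_polyOp [IsProbabilityMeasure ρ]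
    (hindep : ProbabilityTheory.iIndepFun (fun (j : ι) (f : X) => (inner ℝ (ξ j) f : ℝ)) ρ)
    (hlaw : ∀ j, ρ.map (fun f : X => (inner ℝ (ξ j) f : ℝ)) = ρc j)
    (hmom : ∀ j, HasFiniteMoments (ρc j)) (α : MultiIndex κ ι) :
    MemLp (polyOp ξ ψ p α) 2 ρ := by
  have h := memLp_two_prod_coord (measurable_coord ξ) hindep hlaw α.2.support
    (u := fun j x => (p j (α.2 j)).eval x) fun j _ => memLp_two_eval (hmom j) _
  exact MemLp.smul (p := 2) (q := ⊤) (r := 2) (memLp_const (ψ α.1)) h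

theorem integral_inner_polyOp [IsProbabilityMeasure ρ]
    (hindep : ProbabilityTheory.iIndepFun (fun (j : ι) (f : X) => (inner ℝ (ξ j) f : ℝ)) ρ)
    (hlaw : ∀ j, ρ.map (fun f : X => (inner ℝ (ξ j) f : ℝ)) = ρc j)
    (hp : ∀ j, IsOrthonormalPolynomials (ρc j) (p j)) [DecidableEq (MultiIndex κ ι)]
    (α β : MultiIndex κ ι) :
    ∫ f, (inner ℝ (polyOp ξ ψ p α f) (polyOp ξ ψ p β f) : ℝ) ∂ρ = if α = β then 1 else 0 := by
  classical
  let T := α.2.support ∪ β.2.support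
  have h1 : ∀ f : X, (inner ℝ (polyOp ξ ψ p α f) (polyOp ξ ψ p β f) : ℝ) =
      (∏ j ∈ T, (fun x => (p j (α.2 j)).eval x * (p j (β.2 j)).eval x) (inner ℝ (ξ j) f)) *
        inner ℝ (ψ α.1) (ψ β.1) := by
    intro f
    rw [polyOp, polyOp, finsuppProd_eval_eq_prod hp Finset.subset_union_left (T := T),
      finsuppProd_eval_eq_prod hp Finset.subset_union_right (T := T), real_inner_smul_left,
      real_inner_smul_right, ← mul_assoc, ← Finset.prod_mul_distrib]
  simp_rw [h1]
  rw [integral_mul_const, integral_prod_coord (measurable_coord ξ) hindep hlaw T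
    (u := fun j x => (p j (α.2 j)).eval x * (p j (β.2 j)).eval x) fun j _ =>
    ((p j _).continuous.mul (p j _).continuous).aestronglyMeasurable]
  simp_rw [(hp _).orthonormal]
  rw [orthonormal_iff_ite.mp ψ.orthonormal]
  by_cases hα : α = β
  · subst hα; simp
  · rw [if_neg hα]
    by_cases h1 : α.1 = β.1
    · have h2 : α.2 ≠ β.2 := fun h2 => hα (Prod.ext h1 h2)
      obtain ⟨j, hj⟩ := Finsupp.ne_iff.mp h2
      have hjT : j ∈ T := by
        by_contra hjT
        simp only [T, Finset.mem_union, Finsupp.mem_support_iff, not_or, not_not] at hjT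
        exact hj (hjT.1.trans hjT.2.symm)
      rw [Finset.prod_eq_zero hjT (if_neg hj), zero_mul]
    · rw [if_neg h1, mul_zero]

variable [IsProbabilityMeasure ρ]

/-- A square integrable function orthogonal to all `polyOp`s vanishes: each of its coordinates in
the basis of `Y` is orthogonal to all products of orthonormal polynomials. -/
theorem ae_eq_zero_of_orthogonal_polyOp [Countable ι] [Countable κ]
    [TopologicalSpace.SeparableSpace X]
    (hindep : ProbabilityTheory.iIndepFun (fun (j : ι) (f : X) => (inner ℝ (ξ j) f : ℝ)) ρ)
    (hlaw : ∀ j, ρ.map (fun f : X => (inner ℝ (ξ j) f : ℝ)) = ρc j)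
    (hmom : ∀ j, HasFiniteMoments (ρc j)) (hdet : ∀ j, MomentDeterminate (ρc j))
    (hp : ∀ j, IsOrthonormalPolynomials (ρc j) (p j)) {h : X → Y} (hh : MemLp h 2 ρ)
    (horth : ∀ α : MultiIndex κ ι, ∫ f, (inner ℝ (polyOp ξ ψ p α f) (h f) : ℝ) ∂ρ = 0) :
    h =ᵐ[ρ] 0 := by
  have hk : ∀ k, (fun f => (inner ℝ (ψ k) (h f) : ℝ)) =ᵐ[ρ] 0 := by
    intro k
    refine ae_eq_zero_of_orthogonal_prod_coord (ρc := ρc) (borel_eq_iSup_comap_coord ξ)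
      (hh.const_inner (ψ k)) fun T u hu => integral_mul_prod_coord_eq_zero (measurable_coord ξ)
        hindep hlaw hmom hdet hp (hh.const_inner (ψ k)) (fun a => ?_) T hu
    rw [← horth (k, a)]
    congr 1
    ext f
    rw [polyOp, real_inner_smul_left, mul_comm]
  filter_upwards [ae_all_iff.mpr hk] with f hf
  refine ψ.repr.injective ?_
  ext k
  rw [HilbertBasis.repr_apply_apply, hf k]
  simp

theorem exists_hilbertBasis_polyOp [Countable ι] [Countable κ] [CompleteSpace Y]
    [TopologicalSpace.SeparableSpace X]
    (hindep : ProbabilityTheory.iIndepFun (fun (j : ι) (f : X) => (inner ℝ (ξ j) f : ℝ)) ρ)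
    (hlaw : ∀ j, ρ.map (fun f : X => (inner ℝ (ξ j) f : ℝ)) = ρc j)
    (hmom : ∀ j, HasFiniteMoments (ρc j)) (hdet : ∀ j, MomentDeterminate (ρc j))
    (hp : ∀ j, IsOrthonormalPolynomials (ρc j) (p j)) :
    ∃ b : HilbertBasis (MultiIndex κ ι) ℝ (Lp Y 2 ρ),
      ∀ α, (b α : Lp Y 2 ρ) =ᵐ[ρ] polyOp ξ ψ p α := by
  classical
  have hmem : ∀ α, MemLp (polyOp ξ ψ p α) 2 ρ := memLp_polyOp hindep hlaw hmom
  let v : MultiIndex κ ι → Lp Y 2 ρ := fun α => (hmem α).toLp _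
  have hv : ∀ α, v α =ᵐ[ρ] polyOp ξ ψ p α := fun α => (hmem α).coeFn_toLp
  have hon : Orthonormal ℝ v := by
    rw [orthonormal_iff_ite]
    intro α β
    rw [L2.inner_def, ← integral_inner_polyOp hindep hlaw hp (ψ := ψ) α β]
    refine integral_congr_ae ?_
    filter_upwards [hv α, hv β] with f h1 h2
    rw [h1, h2]
  have hbot : (Submodule.span ℝ (Set.range v))ᗮ = ⊥ := by
    rw [Submodule.eq_bot_iff]
    intro h hh
    rw [Lp.eq_zero_iff_ae_eq_zero]
    refine ae_eq_zero_of_orthogonal_polyOp (ψ := ψ) hindep hlaw hmom hdet hp (Lp.memLp h)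
      fun α => ?_
    have h0 := (Submodule.mem_orthogonal _ _).mp hh (v α) (Submodule.subset_span ⟨α, rfl⟩)
    rw [L2.inner_def] at h0
    rw [← h0]
    refine integral_congr_ae ?_
    filter_upwards [hv α] with f h1
    rw [h1]
  refine ⟨HilbertBasis.mkOfOrthogonalEqBot hon hbot, fun α => ?_⟩
  rw [HilbertBasis.coe_mkOfOrthogonalEqBot]
  exact hv α

end Basis

/-- Expansion of a square integrable function in a Hilbert basis of `L²` given by concrete
functions. -/
theorem tendsto_integral_norm_sub_sum_sq {I X Y : Type*} [MeasurableSpace X]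
    [NormedAddCommGroup Y] [InnerProductSpace ℝ Y] [CompleteSpace Y] {ρ : Measure X}
    {P : I → X → Y} (b : HilbertBasis I ℝ (Lp Y 2 ρ)) (hb : ∀ α, (b α : Lp Y 2 ρ) =ᵐ[ρ] P α)
    {K : X → Y} (hK : MemLp K 2 ρ) {Λ : ℕ → Finset I} (hΛ : IsExhaustion Λ) :
    Tendsto (fun N : ℕ => ∫ f, ‖K f - ∑ α ∈ Λ N,
      (∫ g, (inner ℝ (K g) (P α g) : ℝ) ∂ρ) • P α f‖ ^ 2 ∂ρ) atTop (nhds 0) := by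
  have hsum := (b.hasSum_repr (hK.toLp K)).comp (tendsto_atTop_finset_of_monotone hΛ.1 hΛ.2)
  rw [tendsto_iff_norm_sub_tendsto_zero] at hsum
  have hsq := hsum.pow 2
  rw [zero_pow two_ne_zero] at hsq
  refine hsq.congr fun N => ?_
  have hc : ∀ α, b.repr (hK.toLp K) α = ∫ g, (inner ℝ (K g) (P α g) : ℝ) ∂ρ := by
    intro α
    rw [HilbertBasis.repr_apply_apply, L2.inner_def]
    refine integral_congr_ae ?_
    filter_upwards [hb α, hK.coeFn_toLp] with g h1 h2
    rw [h1, h2, real_inner_comm]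
  have hcoe : ∀ s : Finset I, ((∑ α ∈ s, b.repr (hK.toLp K) α • b α : Lp Y 2 ρ) : X → Y) =ᵐ[ρ]
      fun f => ∑ α ∈ s, (∫ g, (inner ℝ (K g) (P α g) : ℝ) ∂ρ) • P α f := by
    classical
    intro s
    induction s using Finset.induction_on with
    | empty => exact Lp.coeFn_zero Y 2 ρ
    | insert α s hα ih =>
      rw [Finset.sum_insert hα]
      filter_upwards [ih, hb α, Lp.coeFn_smul (b.repr (hK.toLp K) α) (b α),
        Lp.coeFn_add (b.repr (hK.toLp K) α • b α)
          (∑ α ∈ s, b.repr (hK.toLp K) α • b α)] with f h1 h2 h3 h4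
      rw [h4, Pi.add_apply, h3, Pi.smul_apply, h1, h2, Finset.sum_insert hα, hc]
  change ‖∑ α ∈ Λ N, b.repr (hK.toLp K) α • b α - hK.toLp K‖ ^ 2 = _
  rw [← real_inner_self_eq_norm_sq, L2.inner_def]
  refine integral_congr_ae ?_
  filter_upwards [hcoe (Λ N), hK.coeFn_toLp,
    Lp.coeFn_sub (∑ α ∈ Λ N, b.repr (hK.toLp K) α • b α) (hK.toLp K)] with f h1 h2 h3
  rw [real_inner_self_eq_norm_sq, h3, Pi.sub_apply, h1, h2, norm_sub_rev]

end PolyOperator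

theorem mainTheorem7
    {ι κ X Y : Type*} [Countable ι] [Countable κ]
    [NormedAddCommGroup X] [InnerProductSpace ℝ X] [CompleteSpace X]
    [TopologicalSpace.SeparableSpace X] [MeasurableSpace X] [BorelSpace X]
    [NormedAddCommGroup Y] [InnerProductSpace ℝ Y] [CompleteSpace Y]
    [TopologicalSpace.SeparableSpace Y]
    (ξ : HilbertBasis ι ℝ X) (ψ : HilbertBasis κ ℝ Y)
    (ρ : MeasureTheory.Measure X) [MeasureTheory.IsProbabilityMeasure ρ]
    (ρc : ι → MeasureTheory.Measure ℝ) [∀ j, MeasureTheory.IsProbabilityMeasure (ρc j)]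
    (hindep : ProbabilityTheory.iIndepFun (fun (j : ι) (f : X) => (inner ℝ (ξ j) f : ℝ)) ρ)
    (hlaw : ∀ j, ρ.map (fun f : X => (inner ℝ (ξ j) f : ℝ)) = ρc j)
    (hmom : ∀ j, PolyOperator.HasFiniteMoments (ρc j))
    (hinc : ∀ j, (PolyOperator.pointsOfIncrease (ProbabilityTheory.cdf (ρc j))).Infinite)
    (hdet : ∀ j, PolyOperator.MomentDeterminate (ρc j)) :
    (∀ j, ∃! p : ℕ → Polynomial ℝ, PolyOperator.IsOrthonormalPolynomials (ρc j) p) ∧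
    ∀ p : ι → ℕ → Polynomial ℝ,
      (∀ j, PolyOperator.IsOrthonormalPolynomials (ρc j) (p j)) →
      (∀ α, MeasureTheory.MemLp (PolyOperator.polyOp ξ ψ p α) 2 ρ) ∧
      (∃ b : HilbertBasis (PolyOperator.MultiIndex κ ι) ℝ (MeasureTheory.Lp Y 2 ρ),
        ∀ α, ∀ᵐ f ∂ρ, (b α : MeasureTheory.Lp Y 2 ρ) f = PolyOperator.polyOp ξ ψ p α f) ∧
      (∀ K : X → Y, MeasureTheory.MemLp K 2 ρ →
        ∀ Λ : ℕ → Finset (PolyOperator.MultiIndex κ ι), PolyOperator.IsExhaustion Λ →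
          Filter.Tendsto
            (fun N : ℕ => ∫ f, ‖K f - ∑ α ∈ Λ N,
              (∫ g, (inner ℝ (K g) (PolyOperator.polyOp ξ ψ p α g) : ℝ) ∂ρ) •
                PolyOperator.polyOp ξ ψ p α f‖ ^ 2 ∂ρ)
            Filter.atTop (nhds 0)) := by
  refine ⟨fun j => PolyOperator.existsUnique_isOrthonormalPolynomials (hmom j) (hinc j),
    fun p hp => ?_⟩
  obtain ⟨b, hb⟩ := PolyOperator.exists_hilbertBasis_polyOp (ψ := ψ) hindep hlaw hmom hdet hp
  exact ⟨PolyOperator.memLp_polyOp hindep hlaw hmom, ⟨b, hb⟩,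
    fun K hK Λ hΛ => PolyOperator.tendsto_integral_norm_sub_sum_sq b hb hK hΛ⟩
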